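/- Let $q$ be a prime power, embed $\mathrm{PG}(6,q)$ in its cubic extension $\mathrm{PG}(6,q^3)$, and write $X\mapsto X^q$ for the collineation of $\mathrm{PG}(6,q^3)$ induced by $x\mapsto x^q$. For a subspace or curve $\mathcal K$ of $\mathrm{PG}(6,q)$ let $\mathcal K^*$ be its natural extension to $\mathrm{PG}(6,q^3)$ (the span of the subspace; for a curve, the points over $\mathbb F_{q^3}$ given by the same equation or parametrization). Let $\Sigma_\infty$ be a hyperplane of $\mathrm{PG}(6,q)$ and let $\mathcal S$ be a regular 2-spread of $\Sigma_\infty$ with transversal lines $g,g^q,g^{q^2}$; that is, $g$ is a line of $\Sigma_\infty^*$ disjoint from $\mathrm{PG}(6,q)$, and the planes $\langle X,X^q,X^{q^2}\rangle\cap\Sigma_\infty$, for $X\in g$, are the elements of $\mathcal S$ and partition the points of $\Sigma_\infty$. Let $\mathcal P(\mathcal S)\cong\mathrm{PG}(2,q^3)$ be the Bruck--Bose plane: its points are the points of $\mathrm{PG}(6,q)\setminus\Sigma_\infty$ together with the elements of $\mathcal S$; its lines are the 3-spaces not contained in $\Sigma_\infty$ that contain an element of $\mathcal S$, together with the line at infinity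 $\ell_\infty$, whose points are the elements of $\mathcal S$; incidence is the natural one. Let $\mathcal C$ be a conic (given by a non-zero quadratic form over $\mathbb F_q$) in a spread element $\pi\in\mathcal S$ such that $\mathcal C^*$ contains the three transversal points $P=\pi^*\cap g$, $P^q=\pi^*\cap g^q$, $P^{q^2}=\pi^*\cap g^{q^2}$. Let $\alpha\in\mathcal S$ with $\alpha\ne\pi$, let $\Sigma$ be a 3-space of $\mathrm{PG}(6,q)$, not contained in $\Sigma_\infty$, with $\alpha\subset\Sigma$, and let $\mathcal N$ be a normal rational curve (twisted cubic) in $\Sigma$ such that $\mathcal N^*$ contains $Q=\alpha^*\cap g$, $Q^q=\alpha^*\cap g^q$, $Q^{q^2}=\alpha^*\cap g^{q^2}$. Then there is a unique projectivity $\kappa:\mathcal C^*\to\mathcal N^*$ with $P^{q^i}\mapsto Q^{q^i}$ for $i=0,1,2$. Let $\mathcal B^*$ be the ruled surface of $\mathrm{PG}(6,q^3)$ with directrices $\mathcal C^*,\mathcal N^*$ defined by $\kappa$, that is, the union of the lines joining $X$ to $\kappa(X)$ for $X\in\mathcal C^*$, and let $\mathcal B=\mathcal B^*\cap\mathrm{PG}(6,q)$.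 Then $\mathcal B$ is a ruled surface of $\mathrm{PG}(6,q)$ with directrices $\mathcal C,\mathcal N$ defined by a projectivity from $\mathcal C$ to $\mathcal N$, and it corresponds to an order-$q$ subplane of $\mathrm{PG}(2,q^3)$ tangent to $\ell_\infty$: the points of $\mathcal B\setminus\Sigma_\infty$ together with the spread elements that meet $\mathcal B$ form the point set of a subplane of order $q$ of $\mathcal P(\mathcal S)\cong\mathrm{PG}(2,q^3)$ that has exactly one point on $\ell_\infty$. -/

import Mathlib

open scoped LinearAlgebra.Projectivization

namespace BruckBose

/-! ### The extension of `PG(n-1, q)` to `PG(n-1, q³)` and the Frobenius collineation -/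

section Extension

variable (F K : Type*) [Field F] [Field K] [Algebra F K] (n : ℕ)

/-- The inclusion `F ^ n → K ^ n`. -/
def extVec : (Fin n → F) →ₛₗ[algebraMap F K] (Fin n → K) where
  toFun v i := algebraMap F K (v i)
  map_add' v w := by ext i; simp
  map_smul' c v := by ext i; simp

theorem extVec_injective : Function.Injective (extVec F K n) := by
  intro v w h
  ext i
  exact (algebraMap F K).injective (congrFun h i)

/-- A point of the small space, regarded as a point of the extended space. -/
def extPt : ℙ F (Fin n → F) → ℙ K (Fin n → K) :=
  Projectivization.map (extVec F K n) (extVec_injective F K n)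

variable {F n} in
/-- The extension `W*` of a subspace `W`. -/
def extSub (W : Submodule F (Fin n → F)) : Submodule K (Fin n → K) :=
  Submodule.span K (extVec F K n '' (W : Set (Fin n → F)))

variable [Fintype F]

/-- The map `(x_i) ↦ (x_i ^ q)` on vectors, where `q = |F|`. -/
def frobVec : (Fin n → K) →ₛₗ[(FiniteField.frobeniusAlgHom F K : K →+* K)] (Fin n → K) where
  toFun v i := FiniteField.frobeniusAlgHom F K (v i)
  map_add' v w := by ext i; exact map_add (FiniteField.frobeniusAlgHom F K) (v i) (w i)
  map_smul' c v := by ext i; exact map_mul (FiniteField.frobeniusAlgHom F K) c (v i)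

theorem frobVec_injective : Function.Injective (frobVec F K n) := by
  intro v w h
  ext i
  exact (FiniteField.frobeniusAlgHom F K : K →+* K).injective (congrFun h i)

/-- The collineation `X ↦ X^q` of the extended space. -/
def frobPt : ℙ K (Fin n → K) → ℙ K (Fin n → K) :=
  Projectivization.map (frobVec F K n) (frobVec_injective F K n)

end Extension

/-! ### Spreads -/

section Spread

variable {F : Type*} [Field F] {n : ℕ}

/-- `S` is a set of planes (subspaces of vector dimension `3`) that partition the points of the
subspace `H`. -/
structure IsTwoSpread (H : Submodule F (Fin n → F)) (S : Set (Submodule F (Fin n → F))) :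
    Prop where
  le : ∀ σ ∈ S, σ ≤ H
  finrank_eq : ∀ σ ∈ S, Module.finrank F σ = 3
  existsUnique : ∀ X : ℙ F (Fin n → F), X.submodule ≤ H → ∃! σ, σ ∈ S ∧ X.submodule ≤ σ

variable {K : Type*} [Field K] [Algebra F K] [Fintype F]

/-- `S` is the regular 2-spread of `H` with transversal lines `g, g^q, g^{q²}`: the line `g` of
the extension of `H` has no point in the small space, `S` is a 2-spread of `H`, and its elements
are the subspaces in which the planes `⟨P, P^q, P^{q²}⟩`, for `P` on `g`, meet the small space. -/
structure IsRegularSpread (H : Submodule F (Fin n → F)) (S : Set (Submodule F (Fin n → F)))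
    (g : Submodule K (Fin n → K)) : Prop where
  isTwoSpread : IsTwoSpread H S
  finrank_eq : Module.finrank K g = 2
  le : g ≤ extSub K H
  disjoint : ∀ X : ℙ F (Fin n → F), ¬ (extPt F K n X).submodule ≤ g
  eq : S = {σ | ∃ P : ℙ K (Fin n → K), P.submodule ≤ g ∧
    σ = (P.submodule ⊔ (frobPt F K n P).submodule ⊔
      (frobPt F K n (frobPt F K n P)).submodule).comap (extVec F K n)}

end Spread

/-! ### Conics, normal rational curves, projectivities, ruled surfaces -/

section Curves

/-- The conic in the plane `U` of `PG(n-1, E)` cut out by the quadratic form `f`, whose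
coefficients lie in a subfield `F` of `E`. -/
def conic {F : Type*} (E : Type*) [Field F] [Field E] [Algebra F E] {n : ℕ}
    (U : Submodule E (Fin n → E)) (f : MvPolynomial (Fin n) F) : Set (ℙ E (Fin n → E)) :=
  {X | X.submodule ≤ U ∧ ∀ v ∈ X.submodule, MvPolynomial.aeval v f = 0}

variable {E V : Type*} [Field E] [AddCommGroup V] [Module E V] {d e : ℕ}

/-- The vector `∑ i, s₀ ^ (d - i) * s₁ ^ i • w i`. -/
def nrcVec (w : Fin (d + 1) → V) (s : Fin 2 → E) : V :=
  ∑ i : Fin (d + 1), (s 0 ^ (d - (i : ℕ)) * s 1 ^ (i : ℕ)) • w i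

/-- For linearly independent `w`, the normal rational curve
`{∑ i, s₀ ^ (d - i) * s₁ ^ i • w i | (s₀ : s₁) ∈ PG(1, E)}` in the `d`-space spanned by `w`. -/
def nrc (E : Type*) {V : Type*} [Field E] [AddCommGroup V] [Module E V] {d : ℕ}
    (w : Fin (d + 1) → V) : Set (ℙ E V) :=
  {X | ∃ s : Fin 2 → E, s ≠ 0 ∧ X.submodule = Submodule.span E {nrcVec w s}}

/-- A map `κ` between a normal rational curve `C` of degree `d` and a normal rational curve `D` of
degree `e` is a projectivity if, for suitable standard parametrizations of `C` and `D` by the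
projective line, it maps each point of `C` to the point of `D` with the same parameter.
(A non-degenerate conic is a normal rational curve of degree `2`.) -/
def IsProjectivity (d e : ℕ) {C D : Set (ℙ E V)} (κ : C → D) : Prop :=
  ∃ (u : Fin (d + 1) → V) (w : Fin (e + 1) → V),
    LinearIndependent E u ∧ LinearIndependent E w ∧ C = nrc E u ∧ D = nrc E w ∧
    ∀ (X : C) (s : Fin 2 → E), s ≠ 0 → X.1.submodule = Submodule.span E {nrcVec u s} →
      (κ X).1.submodule = Submodule.span E {nrcVec w s}

/-- The points on the lines joining `X` and `κ X`, for `X` in `C`. -/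
def ruledSurface {C D : Set (ℙ E V)} (κ : C → D) : Set (ℙ E V) :=
  {R | ∃ X : C, R.submodule ≤ X.1.submodule ⊔ (κ X).1.submodule}

end Curves

/-! ### The Bruck–Bose plane -/

section Plane

variable {F : Type*} [Field F] {n : ℕ}

/-- Points: the points of the space not in the hyperplane `H`, and the spread elements. -/
inductive BBPoint (H : Submodule F (Fin n → F)) (S : Set (Submodule F (Fin n → F)))
  | affine (X : ℙ F (Fin n → F)) (hX : ¬ X.submodule ≤ H)
  | infinite (σ : Submodule F (Fin n → F)) (hσ : σ ∈ S)

/-- Lines: the `3`-spaces not in `H` that contain a spread element, and the line at infinity. -/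
inductive BBLine (H : Submodule F (Fin n → F)) (S : Set (Submodule F (Fin n → F)))
  | affine (l : Submodule F (Fin n → F)) (hl : Module.finrank F l = 4) (hlH : ¬ l ≤ H)
      (hlS : ∃ σ ∈ S, σ ≤ l)
  | infinity

variable {H : Submodule F (Fin n → F)} {S : Set (Submodule F (Fin n → F))}

/-- Incidence of the Bruck–Bose plane. -/
def BBIncident : BBPoint H S → BBLine H S → Prop
  | .affine X _, .affine l _ _ _ => X.submodule ≤ l
  | .infinite σ _, .affine l _ _ _ => σ ≤ l
  | .affine _ _, .infinity => False
  | .infinite _ _, .infinity => True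

instance : Membership (BBPoint H S) (BBLine H S) := ⟨fun l X => BBIncident X l⟩

variable (H S) in
/-- The points of the Bruck–Bose plane that correspond to a set `B` of points of the space: the
affine points of `B`, and the spread elements that contain a point of `B`. -/
def bbSet (B : Set (ℙ F (Fin n → F))) : Set (BBPoint H S) :=
  {p | match p with
    | .affine X _ => X ∈ B
    | .infinite σ _ => ∃ X ∈ B, X.submodule ≤ σ}

end Plane

/-! ### Isomorphisms, subplanes, tangents -/

section Incidence

/-- An isomorphism of incidence structures. -/
structure IncidenceIso (P L P' L' : Type*) [Membership P L] [Membership P' L'] where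
  /-- the map on points -/
  onPoints : P ≃ P'
  /-- the map on lines -/
  onLines : L ≃ L'
  mem_iff : ∀ (p : P) (l : L), onPoints p ∈ onLines l ↔ p ∈ l

variable {P L : Type*} [Membership P L]

variable (L) in
/-- `B` is the set of points of a subplane of order `q`: together with some set `M` of lines and
the inherited incidence it is a projective plane of order `q`. -/
def IsSubplaneOfOrder (B : Set P) (q : ℕ) : Prop :=
  ∃ M : Set L,
    letI : Membership B M := ⟨fun l p => (p : P) ∈ (l : L)⟩
    ∃ _ : Configuration.ProjectivePlane B M, Configuration.ProjectivePlane.order B M = q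

/-- The line `l` is tangent to `B`: it contains exactly one point of `B`. -/
def IsTangent (l : L) (B : Set P) : Prop := ∃! p : P, p ∈ B ∧ p ∈ l

end Incidence

end BruckBose

/-!
The proof is explicit in coordinates. Write `θ₀ = θ, θ₁ = θ^q, θ₂ = θ^{q²}` for conjugate elements of
`K = 𝔽_{q³}` and `Tr` for the coordinatewise trace `K^7 → F^7`.

*The spread.* Since the spread elements are planes, a vector `x ≠ 0` of `g` and its conjugates are
linearly independent, and the spread element with transversal point `⟨x⟩` is `{Tr(kx) | k ∈ K}`
(`IsRegularSpread.comap_conjSpan_eq_range`). So, for a basis `p, ρ` of `g` and a vector `e` outside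
the hyperplane, `Tr(xp + yρ) + ze ↦ (x, y, z)` identifies `F^7` with `K × K × F`, and the Bruck–Bose
plane with `PG(2, K)` (`IsPlaneCoordinates`, `IsPlaneCoordinates.exists_equivs`).

*The curves.* The point `Q` is not rational, so it has a parameter `(θ : 1)` with `θ ∉ F` on the
twisted cubic, and its conjugates have the parameters `(θᵢ : 1)`. With `Lᵢ = s₀ - θᵢ s₁`, Lagrange
interpolation writes the cubic as `L₀L₁L₂ w₀ + s₁ (L₁L₂ ρ + L₀L₂ ρ^q + L₀L₁ ρ^{q²})` for a vector
`ρ` of `Q` (`nrcVec_cubic`). A conic through `P` and its conjugates, but not containing the whole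
plane, becomes for a suitable vector `p` of `P` the curve `L₁L₂ p + L₀L₂ p^q + L₀L₁ p^{q²}`
(`exists_conic_normal_form`, `conic_eq_nrc`). Both parametrizations are defined over `F`, and `P`,
`Q` and their conjugates have equal parameters, so the map that preserves the parameter is a
projectivity as required. It is the only one: cross ratios on a normal rational curve are quotients
of Vandermonde determinants and do not depend on the parametrization (`crossRatio_eq`), so three
points and their images determine a projectivity (`IsProjectivity.preserves_parameter`).

*The subplane.* The two curves span skew subspaces over `F`, so both components of a rational point
of the ruled surface are rational, and the point lies on a line with rational parameter
(`exists_rational_ruling`). For rational `s` the vector `a u(s) + b w(s)` on such a line has the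
coordinates `L₁L₂ (a, b s₁, b (s₀ - θ s₁))`. Hence the ruled surface corresponds to the image of
`PG(2, F)` under the injective linear map `(x, y, z) ↦ (x, y, z - θy)`, a subplane of order `q`; as
`θ ∉ F`, only the image of `(1, 0, 0)` lies on the line at infinity (`isSubplane_and_isTangent`).
-/

namespace BruckBose

/-! ### The Frobenius map, the trace, and extension of scalars -/

section ExtSub

variable {F K : Type*} [Field F] [Field K] [Algebra F K] {n : ℕ}

theorem extVec_smul (a : F) (v : Fin n → F) :
    extVec F K n (a • v) = algebraMap F K a • extVec F K n v :=
  (extVec F K n).map_smulₛₗ a v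

theorem extPt_submodule (X : ℙ F (Fin n → F)) {v : Fin n → F} (h : X.submodule = F ∙ v) :
    (extPt F K n X).submodule = K ∙ extVec F K n v := by
  induction X with
  | h x hx =>
    rw [extPt, Projectivization.map_mk, Projectivization.submodule_mk]
    rw [Projectivization.submodule_mk, Submodule.span_singleton_eq_span_singleton] at h
    obtain ⟨z, rfl⟩ := h
    rw [Submodule.span_singleton_eq_span_singleton]
    refine ⟨Units.map (algebraMap F K) z, ?_⟩
    rw [Units.smul_def z, extVec_smul]
    rfl

theorem extVec_mem_extSub {W : Submodule F (Fin n → F)} {v : Fin n → F} (h : v ∈ W) :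
    extVec F K n v ∈ extSub K W :=
  Submodule.subset_span ⟨v, h, rfl⟩

theorem extSub_mono {W W' : Submodule F (Fin n → F)} (h : W ≤ W') :
    extSub K W ≤ extSub K W' :=
  Submodule.span_mono (Set.image_mono h)

/-- A coordinatewise `F`-linear functional maps the extension of `W` back into `W`. -/
theorem compLeft_mem_of_mem_extSub (ρ : K →ₗ[F] F) {W : Submodule F (Fin n → F)} {x : Fin n → K}
    (hx : x ∈ extSub K W) : ρ.compLeft (Fin n) x ∈ W := by
  induction hx using Submodule.closure_induction with
  | zero => simp
  | add x y _ _ hx hy => rw [map_add]; exact W.add_mem hx hy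
  | smul_mem k x hx =>
    obtain ⟨w, hw, rfl⟩ := hx
    have : ρ.compLeft (Fin n) (k • extVec F K n w) = ρ k • w := by
      ext i
      change ρ (k * algebraMap F K (w i)) = ρ k * w i
      rw [mul_comm, ← Algebra.smul_def, map_smul, smul_eq_mul, mul_comm]
    rw [this]
    exact W.smul_mem _ hw

theorem comap_extSub (W : Submodule F (Fin n → F)) :
    (extSub K W).comap (extVec F K n) = W := by
  refine le_antisymm (fun v hv => ?_) fun v hv => extVec_mem_extSub hv
  obtain ⟨ρ, hρ⟩ := LinearMap.exists_leftInverse_of_injective (Algebra.linearMap F K)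
    (LinearMap.ker_eq_bot.2 (algebraMap F K).injective)
  have h := compLeft_mem_of_mem_extSub ρ (show extVec F K n v ∈ extSub K W from hv)
  convert h
  ext i
  exact (LinearMap.congr_fun hρ (v i)).symm

theorem extVec_mem_extSub_iff {W : Submodule F (Fin n → F)} {v : Fin n → F} :
    extVec F K n v ∈ extSub K W ↔ v ∈ W := by
  conv_rhs => rw [← comap_extSub (K := K) W]
  rfl

theorem linearIndependent_extVec {ι : Type*} {v : ι → Fin n → F}
    (hv : LinearIndependent F v) : LinearIndependent K fun i => extVec F K n (v i) := by
  rw [linearIndependent_iff'] at hv ⊢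
  intro s c hc i hi
  obtain ⟨ρ, hρ⟩ := LinearMap.exists_leftInverse_of_injective (Algebra.linearMap F K)
    (LinearMap.ker_eq_bot.2 (algebraMap F K).injective)
  -- apply the functional `ρ` to the relation scaled so that its `i`-th coefficient is `1`
  by_contra hne
  have h := hv s (fun j => ρ ((c i)⁻¹ * c j)) ?_ i hi
  · rw [inv_mul_cancel₀ hne] at h
    have h1 := LinearMap.congr_fun hρ 1
    simp only [LinearMap.comp_apply, Algebra.linearMap_apply, map_one, h] at h1
    exact zero_ne_one h1
  · ext m
    have h := congrArg (fun x => ρ ((c i)⁻¹ * x)) (congrFun hc m)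
    simp only [Finset.sum_apply, Pi.smul_apply, Pi.zero_apply, mul_zero, map_zero,
      Finset.mul_sum, map_sum] at h
    simp only [Finset.sum_apply, Pi.smul_apply, Pi.zero_apply]
    rw [← h]
    refine Finset.sum_congr rfl fun j _ => ?_
    change ρ ((c i)⁻¹ * c j) * v j m = ρ ((c i)⁻¹ * (c j * algebraMap F K (v j m)))
    rw [← mul_assoc, mul_comm _ (algebraMap F K _), ← Algebra.smul_def, map_smul, smul_eq_mul,
      mul_comm]

theorem finrank_extSub (W : Submodule F (Fin n → F)) :
    Module.finrank K (extSub K W) = Module.finrank F W := by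
  let b := Module.finBasis F W
  have h : extSub K W = Submodule.span K (Set.range fun i => extVec F K n (b i)) := by
    refine le_antisymm (Submodule.span_le.2 ?_) (Submodule.span_mono ?_)
    · rintro _ ⟨w, hw, rfl⟩
      have h2 := congrArg (fun x : W => extVec F K n x) (b.sum_repr ⟨w, hw⟩)
      simp only [Submodule.coe_sum, Submodule.coe_smul, map_sum] at h2
      rw [SetLike.mem_coe, ← h2]
      refine Submodule.sum_mem _ fun i _ => ?_
      rw [extVec_smul]
      exact Submodule.smul_mem _ _ (Submodule.subset_span ⟨i, rfl⟩)
    · rintro _ ⟨i, rfl⟩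
      exact ⟨b i, (b i).2, rfl⟩
  have hb : LinearIndependent F fun i => (b i : Fin n → F) :=
    b.linearIndependent.map' W.subtype W.ker_subtype
  rw [h, finrank_span_eq_card (linearIndependent_extVec hb), Fintype.card_fin]

theorem finrank_comap_extVec_le (W : Submodule K (Fin n → K)) :
    Module.finrank F (W.comap (extVec F K n)) ≤ Module.finrank K W := by
  rw [← finrank_extSub (K := K)]
  refine Submodule.finrank_mono (Submodule.span_le.2 ?_)
  rintro _ ⟨v, hv, rfl⟩
  exact hv

end ExtSub

section Frobenius

variable {F K : Type*} [Field F] [Fintype F] [Field K] [Algebra F K]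

local notation "φ" => FiniteField.frobeniusAlgHom F K

theorem finite_of_finrank_eq_three (hK : Module.finrank F K = 3) : Finite K :=
  have : FiniteDimensional F K := Module.finite_of_finrank_pos (by omega)
  Module.finite_of_finite F

theorem frob_frob_frob (hK : Module.finrank F K = 3) (x : K) : φ (φ (φ x)) = x := by
  have := finite_of_finrank_eq_three hK
  have h := pow_orderOf_eq_one (FiniteField.frobeniusAlgHom F K)
  rw [FiniteField.orderOf_frobeniusAlgHom, hK] at h
  exact DFunLike.congr_fun h x

theorem exists_algebraMap_eq_of_frob_eq (hK : Module.finrank F K = 3) {x : K} (hx : φ x = x) :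
    ∃ a : F, algebraMap F K a = x := by
  have := finite_of_finrank_eq_three hK
  refine (IsGalois.mem_range_algebraMap_iff_fixed x).2 fun f => ?_
  obtain ⟨m, hm⟩ := (FiniteField.bijective_frobeniusAlgEquivOfAlgebraic_pow F K).2 f
  rw [← hm, AlgEquiv.coe_pow]
  exact Function.iterate_fixed (f := ⇑(FiniteField.frobeniusAlgEquivOfAlgebraic F K)) hx m

theorem algebraMap_trace (hK : Module.finrank F K = 3) (x : K) :
    algebraMap F K (Algebra.trace F K x) = x + φ x + φ (φ x) := by
  have := finite_of_finrank_eq_three hK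
  rw [FiniteField.algebraMap_trace_eq_sum_pow, hK]
  simp only [Finset.sum_range_succ, Finset.sum_range_zero, FiniteField.coe_frobeniusAlgHom,
    Fintype.card_eq_nat_card]
  ring

theorem frob_algebraMap (a : F) : φ (algebraMap F K a) = algebraMap F K a :=
  AlgHom.commutes _ a

variable (F K) in
/-- The coordinatewise trace `K ^ n → F ^ n`. -/
noncomputable def traceVec (n : ℕ) : (Fin n → K) →ₗ[F] (Fin n → F) :=
  (Algebra.trace F K).compLeft (Fin n)

variable {n : ℕ}

theorem extVec_traceVec (hK : Module.finrank F K = 3) (x : Fin n → K) :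
    extVec F K n (traceVec F K n x) =
      x + frobVec F K n x + frobVec F K n (frobVec F K n x) := by
  ext i
  exact algebraMap_trace hK (x i)

theorem frobVec_smul (k : K) (x : Fin n → K) :
    frobVec F K n (k • x) = φ k • frobVec F K n x :=
  (frobVec F K n).map_smulₛₗ k x

theorem frobVec_extVec (v : Fin n → F) : frobVec F K n (extVec F K n v) = extVec F K n v := by
  ext i
  exact frob_algebraMap (v i)

theorem frobVec_frobVec_frobVec (hK : Module.finrank F K = 3) (x : Fin n → K) :
    frobVec F K n (frobVec F K n (frobVec F K n x)) = x := by
  ext i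
  exact frob_frob_frob hK (x i)

theorem frobPt_submodule (X : ℙ K (Fin n → K)) {v : Fin n → K} (h : X.submodule = K ∙ v) :
    (frobPt F K n X).submodule = K ∙ frobVec F K n v := by
  induction X with
  | h x hx =>
    rw [frobPt, Projectivization.map_mk, Projectivization.submodule_mk]
    rw [Projectivization.submodule_mk, Submodule.span_singleton_eq_span_singleton] at h
    obtain ⟨z, rfl⟩ := h
    rw [Submodule.span_singleton_eq_span_singleton]
    refine ⟨Units.map (FiniteField.frobeniusAlgHom F K : K →* K) z, ?_⟩
    rw [Units.smul_def z, frobVec_smul]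
    rfl

end Frobenius

/-! ### Normal rational curves and their parameters -/

section Bracket

variable {E : Type*} [Field E]

/-- The bracket `s₀ t₁ - s₁ t₀` of two vectors; it vanishes when they represent the same point of
the projective line. -/
def bracket (s t : Fin 2 → E) : E := s 0 * t 1 - s 1 * t 0

theorem exists_smul_eq_of_bracket_eq_zero {s t : Fin 2 → E} (hs : s ≠ 0) (ht : t ≠ 0)
    (h : bracket s t = 0) : ∃ c : E, c ≠ 0 ∧ t = c • s := by
  have hex : ∃ c : E, t = c • s := by
    unfold bracket at h
    by_cases h0 : s 0 = 0
    · have h1 : s 1 ≠ 0 := fun h1 => hs (by ext i; fin_cases i <;> simp [h0, h1])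
      refine ⟨t 1 / s 1, ?_⟩
      have ht0 : t 0 = 0 := by
        rw [h0, zero_mul, zero_sub, neg_eq_zero, mul_eq_zero] at h
        exact h.resolve_left h1
      ext i
      fin_cases i
      · simp [h0, ht0]
      · simp [h1]
    · refine ⟨t 0 / s 0, ?_⟩
      ext i
      fin_cases i
      · simp [h0]
      · simp only [Fin.mk_one, Pi.smul_apply, smul_eq_mul]
        field_simp
        linear_combination h
  obtain ⟨c, rfl⟩ := hex
  exact ⟨c, fun hc => ht (by rw [hc, zero_smul]), rfl⟩

/-- If the field has at least `m + 4` elements, then there are `m` points of the projective line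
that are distinct from each other and from four given points. -/
theorem exists_points_avoiding [Finite E] {m : ℕ} (hm : m + 4 ≤ Nat.card E)
    (y : Fin 4 → Fin 2 → E) (hy : ∀ i, y i ≠ 0) :
    ∃ z : Fin m → Fin 2 → E, (∀ k, z k ≠ 0) ∧ (∀ i k, bracket (y i) (z k) ≠ 0) ∧
      ∀ k l, k ≠ l → bracket (z k) (z l) ≠ 0 := by
  classical
  have := Fintype.ofFinite E
  rw [Nat.card_eq_fintype_card] at hm
  -- among the points `(1, t)` only `t = y₁ / y₀` represents the same point as `y`
  let bad : Finset E := Finset.univ.image fun i => y i 1 / y i 0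
  have hbad : bad.card ≤ 4 := Finset.card_image_le.trans (by simp)
  have hcard : m ≤ (badᶜ).card := by rw [Finset.card_compl]; omega
  obtain ⟨G, hG, hGm⟩ := Finset.exists_subset_card_eq hcard
  let e := G.equivFinOfCardEq hGm
  refine ⟨fun k => ![1, (e.symm k : E)], fun k h => ?_, fun i k h => ?_, fun k l hkl h => ?_⟩
  · exact one_ne_zero (congrFun h 0)
  · have hk := hG (e.symm k).2
    rw [Finset.mem_compl] at hk
    simp only [bracket, Matrix.cons_val_zero, Matrix.cons_val_one] at h
    have h0 : y i 0 ≠ 0 := by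
      intro h0
      rw [h0] at h
      refine hy i ?_
      ext j
      fin_cases j
      · exact h0
      · simpa using h
    refine hk (Finset.mem_image.2 ⟨i, Finset.mem_univ _, ?_⟩)
    rw [div_eq_iff h0]
    linear_combination -h
  · simp only [bracket, Matrix.cons_val_zero, Matrix.cons_val_one] at h
    refine hkl (e.symm.injective (Subtype.ext ?_))
    linear_combination -h

end Bracket

section Nrc

variable {E V : Type*} [Field E] [AddCommGroup V] [Module E V] {d : ℕ}

theorem nrcVec_smul (w : Fin (d + 1) → V) (c : E) (s : Fin 2 → E) :
    nrcVec w (c • s) = c ^ d • nrcVec w s := by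
  simp only [nrcVec, Finset.smul_sum, smul_smul, Pi.smul_apply, smul_eq_mul]
  refine Finset.sum_congr rfl fun i _ => ?_
  congr 1
  have : c ^ d = c ^ (d - (i : ℕ)) * c ^ (i : ℕ) := by rw [← pow_add]; congr 1; omega
  rw [this, mul_pow, mul_pow]
  ring

theorem nrcVec_coeff_eq {w : Fin (d + 1) → V} (hw : LinearIndependent E w) {s t : Fin 2 → E}
    {c : E} (h : nrcVec w t = c • nrcVec w s) (i : Fin (d + 1)) :
    t 0 ^ (d - (i : ℕ)) * t 1 ^ (i : ℕ) = c * (s 0 ^ (d - (i : ℕ)) * s 1 ^ (i : ℕ)) := by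
  simp only [nrcVec, Finset.smul_sum, smul_smul] at h
  exact Fintype.linearIndependent_iff.1 hw
    (fun i => t 0 ^ (d - (i : ℕ)) * t 1 ^ (i : ℕ) - c * (s 0 ^ (d - (i : ℕ)) * s 1 ^ (i : ℕ)))
    (by simp only [sub_smul, Finset.sum_sub_distrib, h, sub_self]) i |> sub_eq_zero.1

theorem nrcVec_ne_zero {w : Fin (d + 1) → V} (hw : LinearIndependent E w) {s : Fin 2 → E}
    (hs : s ≠ 0) : nrcVec w s ≠ 0 := by
  intro h
  have h' : nrcVec w s = (0 : E) • nrcVec w s := by rw [h, smul_zero]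
  have h0 := nrcVec_coeff_eq hw h' 0
  have h1 := nrcVec_coeff_eq hw h' (Fin.last d)
  simp only [Fin.val_zero, Nat.sub_zero, pow_zero, mul_one, zero_mul, Fin.val_last, Nat.sub_self,
    one_mul] at h0 h1
  refine hs ?_
  ext i
  fin_cases i
  · exact eq_zero_of_pow_eq_zero h0
  · exact eq_zero_of_pow_eq_zero h1

/-- A point of a normal rational curve determines its parameter. -/
theorem bracket_eq_zero_of_nrcVec_eq (hd : 1 ≤ d) {w : Fin (d + 1) → V}
    (hw : LinearIndependent E w) {s t : Fin 2 → E} (ht : t ≠ 0) {c : E}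
    (h : nrcVec w t = c • nrcVec w s) : bracket s t = 0 := by
  obtain ⟨m, rfl⟩ : ∃ m, d = m + 1 := ⟨d - 1, by omega⟩
  have hc : c ≠ 0 := by
    rintro rfl
    exact nrcVec_ne_zero hw ht (by rw [h, zero_smul])
  have h0 := nrcVec_coeff_eq hw h 0
  have h1 := nrcVec_coeff_eq hw h 1
  simp only [Fin.val_zero, Nat.sub_zero, pow_zero, mul_one, Fin.val_one, pow_one,
    Nat.add_sub_cancel] at h0 h1
  unfold bracket
  by_cases hs0 : s 0 = 0
  · have ht0 : t 0 = 0 := by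
      rw [hs0, zero_pow (by omega), mul_zero] at h0
      exact eq_zero_of_pow_eq_zero h0
    rw [hs0, ht0]
    ring
  · have ht0 : t 0 ≠ 0 := by
      intro ht0
      rw [ht0, zero_pow (by omega)] at h0
      exact mul_ne_zero hc (pow_ne_zero _ hs0) h0.symm
    refine (mul_eq_zero.1 (?_ : t 0 ^ m * (s 0 * t 1 - s 1 * t 0) = 0)).resolve_left
      (pow_ne_zero _ ht0)
    linear_combination s 0 * h1 - s 1 * h0

theorem span_nrcVec_eq_of_bracket_eq_zero (w : Fin (d + 1) → V) {s t : Fin 2 → E} (hs : s ≠ 0)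
    (ht : t ≠ 0) (h : bracket s t = 0) :
    Submodule.span E {nrcVec w t} = Submodule.span E {nrcVec w s} := by
  obtain ⟨c, hc, rfl⟩ := exists_smul_eq_of_bracket_eq_zero hs ht h
  rw [nrcVec_smul]
  exact Submodule.span_singleton_smul_eq (IsUnit.mk0 _ (pow_ne_zero _ hc)) _

theorem exists_eq_smul_of_span_eq {x y : V} (h : Submodule.span E {x} = Submodule.span E {y}) :
    ∃ c : E, x = c • y := by
  obtain ⟨c, hc⟩ := Submodule.mem_span_singleton.1
    (h ▸ Submodule.mem_span_singleton_self x : x ∈ Submodule.span E {y})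
  exact ⟨c, hc.symm⟩

theorem bracket_eq_zero_of_span_eq (hd : 1 ≤ d) {w : Fin (d + 1) → V}
    (hw : LinearIndependent E w) {s t : Fin 2 → E} (ht : t ≠ 0)
    (h : Submodule.span E {nrcVec w t} = Submodule.span E {nrcVec w s}) : bracket s t = 0 :=
  have ⟨_, hc⟩ := exists_eq_smul_of_span_eq h
  bracket_eq_zero_of_nrcVec_eq hd hw ht hc

theorem exists_mem_nrc {w : Fin (d + 1) → V} (hw : LinearIndependent E w) {s : Fin 2 → E}
    (hs : s ≠ 0) : ∃ X ∈ nrc E w, X.submodule = Submodule.span E {nrcVec w s} :=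
  ⟨Projectivization.mk E _ (nrcVec_ne_zero hw hs),
    ⟨s, hs, Projectivization.submodule_mk _ _⟩, Projectivization.submodule_mk _ _⟩

/-- The map between normal rational curves that preserves the parameters of given
parametrizations. -/
theorem exists_parameter_map {e : ℕ} (hd : 1 ≤ d) {u : Fin (d + 1) → V}
    (hu : LinearIndependent E u) {w : Fin (e + 1) → V} (hw : LinearIndependent E w)
    {C : Set (ℙ E V)} (hC : C = nrc E u) :
    ∃ κ : C → nrc E w, ∀ (X : C) (s : Fin 2 → E), s ≠ 0 →
      X.1.submodule = Submodule.span E {nrcVec u s} →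
      (κ X).1.submodule = Submodule.span E {nrcVec w s} := by
  subst hC
  choose p hp0 hp using fun X : nrc E u => X.2
  choose Y hY hY' using fun X : nrc E u => exists_mem_nrc hw (hp0 X)
  refine ⟨fun X => ⟨Y X, hY X⟩, fun X s hs hX => ?_⟩
  refine (hY' X).trans ?_
  exact (span_nrcVec_eq_of_bracket_eq_zero w (hp0 X) hs
    (bracket_eq_zero_of_span_eq hd hu hs (hX.symm.trans (hp X)))).symm

end Nrc

/-! ### Cross ratios on a normal rational curve

The determinant of the coordinates of `d + 1` points of a normal rational curve of degree `d` is the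
product of the brackets of their parameters. So the cross ratio of the parameters of four points is
a quotient of determinants, and it depends only on the points and not on the parametrization. -/

section CrossRatio

variable {E V : Type*} [Field E] [AddCommGroup V] [Module E V] {d : ℕ}

/-- The coordinates of the points with parameters `τ i` of a normal rational curve. -/
def paramMatrix (τ : Fin (d + 1) → Fin 2 → E) : Matrix (Fin (d + 1)) (Fin (d + 1)) E :=
  Matrix.projVandermonde (fun i => τ i 1) fun i => τ i 0

theorem nrcVec_eq_sum_paramMatrix (w : Fin (d + 1) → V) (τ : Fin (d + 1) → Fin 2 → E)
    (i : Fin (d + 1)) : nrcVec w (τ i) = ∑ j, paramMatrix τ i j • w j := by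
  refine Finset.sum_congr rfl fun j _ => ?_
  rw [paramMatrix, Matrix.projVandermonde_apply, Fin.val_rev, mul_comm]
  congr 3
  omega

theorem det_paramMatrix (τ : Fin (d + 1) → Fin 2 → E) :
    (paramMatrix τ).det = ∏ i, ∏ j ∈ Finset.Ioi i, bracket (τ i) (τ j) := by
  rw [paramMatrix, Matrix.det_projVandermonde]
  refine Finset.prod_congr rfl fun i _ => Finset.prod_congr rfl fun j _ => ?_
  unfold bracket
  ring

theorem det_paramMatrix_cons {m : ℕ} (a b : Fin 2 → E) (z : Fin m → Fin 2 → E) :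
    (paramMatrix (d := m + 1) (Matrix.vecCons a (Matrix.vecCons b z))).det =
      bracket a b * (∏ k, bracket a (z k)) * (∏ k, bracket b (z k)) *
        ∏ i, ∏ j ∈ Finset.Ioi i, bracket (z i) (z j) := by
  rw [det_paramMatrix, Fin.prod_univ_succ, Fin.prod_univ_succ]
  simp only [Fin.prod_Ioi_zero, Fin.prod_Ioi_succ, Fin.prod_univ_succ, Matrix.cons_val_zero,
    Matrix.cons_val_succ]
  ring

/-- Two frames of the same normal rational curve differ by an invertible matrix. -/
theorem exists_frame_change {u u' : Fin (d + 1) → V} (hu : LinearIndependent E u)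
    {τ τ' : Fin (d + 1) → Fin 2 → E} {c : Fin (d + 1) → E} (hτ : (paramMatrix τ).det ≠ 0)
    (h : ∀ i, nrcVec u (τ i) = c i • nrcVec u' (τ' i)) :
    ∃ A : Matrix (Fin (d + 1)) (Fin (d + 1)) E, A.det ≠ 0 ∧ ∀ i, u i = ∑ j, A i j • u' j := by
  have hinv := Matrix.nonsing_inv_mul (paramMatrix τ) (isUnit_iff_ne_zero.2 hτ)
  let A := (paramMatrix τ)⁻¹ * (Matrix.diagonal c * paramMatrix τ')
  have hA : ∀ i, u i = ∑ j, A i j • u' j := by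
    intro i
    have h1 : ∀ k, ∑ j, paramMatrix τ k j • u j =
        ∑ j, (Matrix.diagonal c * paramMatrix τ') k j • u' j := by
      intro k
      rw [← nrcVec_eq_sum_paramMatrix, h k, nrcVec_eq_sum_paramMatrix, Finset.smul_sum]
      simp only [Matrix.diagonal_mul, smul_smul]
    calc u i = ∑ j, ((paramMatrix τ)⁻¹ * paramMatrix τ) i j • u j := by
          rw [hinv]
          simp [Matrix.one_apply]
      _ = ∑ k, (paramMatrix τ)⁻¹ i k • ∑ j, paramMatrix τ k j • u j := by
          simp only [Matrix.mul_apply, Finset.sum_smul, Finset.smul_sum, smul_smul]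
          exact Finset.sum_comm
      _ = ∑ j, A i j • u' j := by
          simp only [h1, A, Matrix.mul_apply (M := (paramMatrix τ)⁻¹), Finset.sum_smul,
            Finset.smul_sum, smul_smul]
          exact Finset.sum_comm
  refine ⟨A, fun hdet => ?_, hA⟩
  obtain ⟨v, hv0, hv⟩ := Matrix.exists_vecMul_eq_zero_iff.2 hdet
  refine hv0 (funext (Fintype.linearIndependent_iff.1 hu v ?_))
  simp only [hA, Finset.smul_sum, smul_smul]
  rw [Finset.sum_comm]
  refine Finset.sum_eq_zero fun j _ => ?_
  rw [← Finset.sum_smul]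
  have := congrFun hv j
  simp only [Matrix.vecMul, dotProduct, Pi.zero_apply] at this
  rw [this, zero_smul]

theorem det_paramMatrix_mul_det {u u' : Fin (d + 1) → V} (hu' : LinearIndependent E u')
    {A : Matrix (Fin (d + 1)) (Fin (d + 1)) E} (hA : ∀ i, u i = ∑ j, A i j • u' j)
    {τ τ' : Fin (d + 1) → Fin 2 → E} {c : Fin (d + 1) → E}
    (h : ∀ i, nrcVec u (τ i) = c i • nrcVec u' (τ' i)) :
    (paramMatrix τ).det * A.det = (∏ i, c i) * (paramMatrix τ').det := by
  have : paramMatrix τ * A = Matrix.diagonal c * paramMatrix τ' := by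
    ext i j
    have h1 := h i
    rw [nrcVec_eq_sum_paramMatrix, nrcVec_eq_sum_paramMatrix] at h1
    simp only [hA, Finset.smul_sum, smul_smul] at h1
    rw [Finset.sum_comm] at h1
    simp only [← Finset.sum_smul] at h1
    have h2 := Fintype.linearIndependent_iff.1 hu'
      (fun j => (paramMatrix τ * A) i j - c i * paramMatrix τ' i j)
      (by simp only [sub_smul, Finset.sum_sub_distrib, Matrix.mul_apply, h1, sub_self]) j
    rw [Matrix.diagonal_mul]
    exact sub_eq_zero.1 h2
  rw [← Matrix.det_mul, this, Matrix.det_mul, Matrix.det_diagonal]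

/-- Cross ratios do not depend on the parametrization: `x'` is the parameter with respect to `u'`
of the point with parameter `x` with respect to `u`. -/
theorem crossRatio_eq {m : ℕ} {u u' : Fin (m + 2) → V} (hu : LinearIndependent E u)
    (hu' : LinearIndependent E u') {a b c x a' b' c' x' : Fin 2 → E} {z z' : Fin m → Fin 2 → E}
    {ka kb kc kx : E} {kz : Fin m → E}
    (ha : nrcVec (d := m + 1) u a = ka • nrcVec (d := m + 1) u' a')
    (hb : nrcVec (d := m + 1) u b = kb • nrcVec (d := m + 1) u' b')
    (hc : nrcVec (d := m + 1) u c = kc • nrcVec (d := m + 1) u' c')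
    (hx : nrcVec (d := m + 1) u x = kx • nrcVec (d := m + 1) u' x')
    (hz : ∀ i, nrcVec (d := m + 1) u (z i) = kz i • nrcVec (d := m + 1) u' (z' i))
    (hac : bracket a c ≠ 0) (haz : ∀ i, bracket a (z i) ≠ 0) (hbz : ∀ i, bracket b (z i) ≠ 0)
    (hcz : ∀ i, bracket c (z i) ≠ 0) (hxz : ∀ i, bracket x (z i) ≠ 0)
    (hzz : ∀ i j, i ≠ j → bracket (z i) (z j) ≠ 0) :
    bracket a c * bracket b x * (bracket a' x' * bracket b' c') =
      bracket a x * bracket b c * (bracket a' c' * bracket b' x') := by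
  have hrel : ∀ {s t s' t' : Fin 2 → E} {ks kt : E},
      nrcVec (d := m + 1) u s = ks • nrcVec (d := m + 1) u' s' →
      nrcVec (d := m + 1) u t = kt • nrcVec (d := m + 1) u' t' →
      ∀ i, nrcVec (d := m + 1) u (Matrix.vecCons s (Matrix.vecCons t z) i) =
        Matrix.vecCons ks (Matrix.vecCons kt kz) i •
          nrcVec (d := m + 1) u' (Matrix.vecCons s' (Matrix.vecCons t' z') i) := by
    intro s t s' t' ks kt hs ht i
    refine Fin.cases ?_ (fun i => Fin.cases ?_ (fun i => ?_) i) i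
    · exact hs
    · exact ht
    · exact hz i
  have hZ : ∏ i, ∏ j ∈ Finset.Ioi i, bracket (z i) (z j) ≠ 0 :=
    Finset.prod_ne_zero_iff.2 fun i _ => Finset.prod_ne_zero_iff.2 fun j hj =>
      hzz i j (Finset.mem_Ioi.1 hj).ne
  have hA := Finset.prod_ne_zero_iff.2 fun i (_ : i ∈ Finset.univ) => haz i
  have hB := Finset.prod_ne_zero_iff.2 fun i (_ : i ∈ Finset.univ) => hbz i
  have hC := Finset.prod_ne_zero_iff.2 fun i (_ : i ∈ Finset.univ) => hcz i
  have hX := Finset.prod_ne_zero_iff.2 fun i (_ : i ∈ Finset.univ) => hxz i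
  obtain ⟨M, hM, hMu⟩ := exists_frame_change hu
    (τ := Matrix.vecCons a (Matrix.vecCons c z))
    (by rw [det_paramMatrix_cons]; exact mul_ne_zero (mul_ne_zero (mul_ne_zero hac hA) hC) hZ)
    (hrel ha hc)
  have e1 := det_paramMatrix_mul_det hu' hMu (hrel ha hc)
  have e2 := det_paramMatrix_mul_det hu' hMu (hrel hb hx)
  have e3 := det_paramMatrix_mul_det hu' hMu (hrel ha hx)
  have e4 := det_paramMatrix_mul_det hu' hMu (hrel hb hc)
  rw [det_paramMatrix_cons, det_paramMatrix_cons, Fin.prod_univ_succ, Fin.prod_univ_succ]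
    at e1 e2 e3 e4
  simp only [Matrix.cons_val_zero, Matrix.cons_val_succ] at e1 e2 e3 e4
  generalize (∏ i, ∏ j ∈ Finset.Ioi i, bracket (z i) (z j)) = Z at *
  generalize (∏ i, ∏ j ∈ Finset.Ioi i, bracket (z' i) (z' j)) = Z' at *
  generalize (∏ i, bracket a (z i)) = A at *
  generalize (∏ i, bracket b (z i)) = B at *
  generalize (∏ i, bracket c (z i)) = C at *
  generalize (∏ i, bracket x (z i)) = X at *
  generalize (∏ i, bracket a' (z' i)) = A' at *
  generalize (∏ i, bracket b' (z' i)) = B' at *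
  generalize (∏ i, bracket c' (z' i)) = C' at *
  generalize (∏ i, bracket x' (z' i)) = X' at *
  generalize (∏ i, kz i) = k at *
  have e12 := congrArg₂ (· * ·) e1 e2
  have e34 := congrArg₂ (· * ·) e3 e4
  have hK : A * B * C * X * Z ^ 2 * M.det ^ 2 ≠ 0 :=
    mul_ne_zero (mul_ne_zero (mul_ne_zero (mul_ne_zero (mul_ne_zero hA hB) hC) hX)
      (pow_ne_zero _ hZ)) (pow_ne_zero _ hM)
  refine mul_left_cancel₀ hK ?_
  linear_combination bracket a' x' * bracket b' c' * e12 - bracket a' c' * bracket b' x' * e34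

end CrossRatio

/-! ### Projectivities between normal rational curves -/

section Projectivity

variable {E V : Type*} [Field E] [AddCommGroup V] [Module E V]

theorem exists_param {d : ℕ} {u u' : Fin (d + 1) → V} (hu : LinearIndependent E u)
    (h : nrc E u = nrc E u') (s : Fin 2 → E) (hs : s ≠ 0) :
    ∃ t : Fin 2 → E, t ≠ 0 ∧ Submodule.span E {nrcVec u s} = Submodule.span E {nrcVec u' t} := by
  obtain ⟨X, hX, hX'⟩ := exists_mem_nrc hu hs
  rw [h] at hX
  obtain ⟨t, ht, hXt⟩ := hX
  exact ⟨t, ht, hX'.symm.trans hXt⟩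

theorem crossRatio_eq_of_nrc_eq [Finite E] {d : ℕ} (hd : 1 ≤ d) (hcard : d + 3 ≤ Nat.card E)
    {u u' : Fin (d + 1) → V} (hu : LinearIndependent E u) (hu' : LinearIndependent E u')
    (h : nrc E u = nrc E u') {a b c x a' b' c' x' : Fin 2 → E} (ha0 : a ≠ 0) (hb0 : b ≠ 0)
    (hc0 : c ≠ 0) (hx0 : x ≠ 0)
    (ha : Submodule.span E {nrcVec u a} = Submodule.span E {nrcVec u' a'})
    (hb : Submodule.span E {nrcVec u b} = Submodule.span E {nrcVec u' b'})
    (hc : Submodule.span E {nrcVec u c} = Submodule.span E {nrcVec u' c'})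
    (hx : Submodule.span E {nrcVec u x} = Submodule.span E {nrcVec u' x'})
    (hac : bracket a c ≠ 0) :
    bracket a c * bracket b x * (bracket a' x' * bracket b' c') =
      bracket a x * bracket b c * (bracket a' c' * bracket b' x') := by
  obtain ⟨m, rfl⟩ : ∃ m, d = m + 1 := ⟨d - 1, by omega⟩
  obtain ⟨z, hz0, hyz, hzz⟩ := exists_points_avoiding (E := E) (m := m) (by omega)
    ![a, b, c, x] (by intro i; fin_cases i <;> assumption)
  choose z' _ hz' using fun k => exists_param hu h (z k) (hz0 k)
  choose kz hkz using fun k => exists_eq_smul_of_span_eq (hz' k)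
  obtain ⟨ka, ha⟩ := exists_eq_smul_of_span_eq ha
  obtain ⟨kb, hb⟩ := exists_eq_smul_of_span_eq hb
  obtain ⟨kc, hc⟩ := exists_eq_smul_of_span_eq hc
  obtain ⟨kx, hx⟩ := exists_eq_smul_of_span_eq hx
  exact crossRatio_eq hu hu' ha hb hc hx hkz hac (hyz 0) (hyz 1) (hyz 2) (hyz 3) hzz

/-- A projectivity between normal rational curves is determined by the images of three points: if it
preserves the parameters of three points with respect to given parametrizations, then it preserves
all parameters. -/
theorem IsProjectivity.preserves_parameter [Finite E] {d e : ℕ} (hd : 1 ≤ d) (he : 1 ≤ e)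
    (hcd : d + 3 ≤ Nat.card E) (hce : e + 3 ≤ Nat.card E) {C D : Set (ℙ E V)} {κ : C → D}
    (hκ : IsProjectivity d e κ) {u : Fin (d + 1) → V} {w : Fin (e + 1) → V}
    (hu : LinearIndependent E u) (hw : LinearIndependent E w) (hC : C = nrc E u) (hD : D = nrc E w)
    {a b c : Fin 2 → E} (ha0 : a ≠ 0) (hb0 : b ≠ 0) (hc0 : c ≠ 0) (hab : bracket a b ≠ 0)
    (hac : bracket a c ≠ 0) (hbc : bracket b c ≠ 0) {A B Γ : C}
    (hA : A.1.submodule = Submodule.span E {nrcVec u a})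
    (hB : B.1.submodule = Submodule.span E {nrcVec u b})
    (hΓ : Γ.1.submodule = Submodule.span E {nrcVec u c})
    (hκA : (κ A).1.submodule = Submodule.span E {nrcVec w a})
    (hκB : (κ B).1.submodule = Submodule.span E {nrcVec w b})
    (hκΓ : (κ Γ).1.submodule = Submodule.span E {nrcVec w c})
    (X : C) {x : Fin 2 → E} (hx0 : x ≠ 0) (hX : X.1.submodule = Submodule.span E {nrcVec u x}) :
    (κ X).1.submodule = Submodule.span E {nrcVec w x} := by
  obtain ⟨u', w', hu', hw', hC', hD', hκ⟩ := hκ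
  have hCC : nrc E u = nrc E u' := hC.symm.trans hC'
  have hDD : nrc E w = nrc E w' := hD.symm.trans hD'
  obtain ⟨a', ha0', ha'⟩ := exists_param hu hCC a ha0
  obtain ⟨b', hb0', hb'⟩ := exists_param hu hCC b hb0
  obtain ⟨c', hc0', hc'⟩ := exists_param hu hCC c hc0
  obtain ⟨x', hx0', hx'⟩ := exists_param hu hCC x hx0
  have hκX := hκ X x' hx0' (hX.trans hx')
  obtain ⟨y, hy0, hy⟩ : (κ X).1 ∈ nrc E w := hD ▸ (κ X).2
  -- a point of the curve with the same parameter as one of the three given points is that point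
  have hsame : ∀ {Y : C} {s : Fin 2 → E}, s ≠ 0 →
      Y.1.submodule = Submodule.span E {nrcVec u s} →
      (κ Y).1.submodule = Submodule.span E {nrcVec w s} → bracket s x = 0 →
      (κ X).1.submodule = Submodule.span E {nrcVec w x} := by
    intro Y s hs0 hY hκY hsx
    have hXY : X = Y := Subtype.ext (Projectivization.submodule_injective (by
      rw [hX, hY, span_nrcVec_eq_of_bracket_eq_zero u hs0 hx0 hsx]))
    rw [hXY, hκY, span_nrcVec_eq_of_bracket_eq_zero w hs0 hx0 hsx]
  by_cases hax : bracket a x = 0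
  · exact hsame ha0 hA hκA hax
  by_cases hbx : bracket b x = 0
  · exact hsame hb0 hB hκB hbx
  have cr1 := crossRatio_eq_of_nrc_eq hd hcd hu hu' hCC ha0 hb0 hc0 hx0 ha' hb' hc' hx' hac
  have cr2 := crossRatio_eq_of_nrc_eq he hce hw hw' hDD ha0 hb0 hc0 hy0
    (hκA.symm.trans (hκ A a' ha0' (hA.trans ha'))) (hκB.symm.trans (hκ B b' hb0' (hB.trans hb')))
    (hκΓ.symm.trans (hκ Γ c' hc0' (hΓ.trans hc'))) (hy.symm.trans hκX) hac
  have hne : ∀ {s t s' t' : Fin 2 → E}, t ≠ 0 → s' ≠ 0 → t' ≠ 0 →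
      Submodule.span E {nrcVec u s} = Submodule.span E {nrcVec u' s'} →
      Submodule.span E {nrcVec u t} = Submodule.span E {nrcVec u' t'} →
      bracket s t ≠ 0 → bracket s' t' ≠ 0 := by
    intro s t s' t' ht hs' ht' hs1 ht1 hst hst'
    refine hst (bracket_eq_zero_of_span_eq hd hu ht ?_)
    rw [hs1, ht1, span_nrcVec_eq_of_bracket_eq_zero u' hs' ht' hst']
  have n1 := hne hx0 ha0' hx0' ha' hx' hax
  have n2 := hne hc0 hb0' hc0' hb' hc' hbc
  have n3 := hne hc0 ha0' hc0' ha' hc' hac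
  have n4 := hne hx0 hb0' hx0' hb' hx' hbx
  have hxy : bracket x y = 0 := by
    have h1 : bracket a c * bracket b c * (bracket a' x' * bracket b' c' *
        (bracket a' c' * bracket b' x')) * bracket a b * bracket x y = 0 := by
      have pl : bracket a b * bracket x y =
          bracket a x * bracket b y - bracket a y * bracket b x := by
        unfold bracket; ring
      linear_combination bracket a c * bracket b c * (bracket a' x' * bracket b' c' *
        (bracket a' c' * bracket b' x')) * pl
        + (bracket b c * bracket a' c' * bracket b' x' * bracket a x) * cr2
        - (bracket b c * bracket a' c' * bracket b' x' * bracket a y) * cr1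
    exact (mul_eq_zero.1 h1).resolve_left (mul_ne_zero (mul_ne_zero (mul_ne_zero hac hbc)
      (mul_ne_zero (mul_ne_zero n1 n2) (mul_ne_zero n3 n4))) hab)
  rw [hy, span_nrcVec_eq_of_bracket_eq_zero w hx0 hy0 hxy]

end Projectivity

/-! ### Rational points of an extended normal rational curve -/

section Rational

variable {F K : Type*} [Field F] [Field K] [Algebra F K] {n d : ℕ}

theorem nrcVec_extVec (w : Fin (d + 1) → Fin n → F) (s : Fin 2 → F) :
    nrcVec (fun j => extVec F K n (w j)) (extVec F K 2 s) = extVec F K n (nrcVec w s) := by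
  simp only [nrcVec, map_sum]
  refine Finset.sum_congr rfl fun i _ => ?_
  rw [extVec_smul, map_mul, map_pow, map_pow]
  rfl

theorem extVec_ne_zero {v : Fin n → F} (hv : v ≠ 0) : extVec F K n v ≠ 0 := fun h =>
  hv (extVec_injective F K n (h.trans (map_zero _).symm))

/-- A rational point of an extended normal rational curve has a rational parameter. -/
theorem exists_rational_param (hd : 1 ≤ d) {u : Fin (d + 1) → Fin n → F}
    (hu : LinearIndependent F u) {v : Fin n → F} (hv : v ≠ 0) {s : Fin 2 → K} (hs : s ≠ 0) {k : K}
    (h : extVec F K n v = k • nrcVec (fun j => extVec F K n (u j)) s) :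
    ∃ (t : Fin 2 → F) (c : K), t ≠ 0 ∧ c ≠ 0 ∧ s = c • extVec F K 2 t := by
  have hmem : v ∈ Submodule.span F (Set.range u) := by
    rw [← extVec_mem_extSub_iff (K := K), h]
    refine Submodule.smul_mem _ _ (Submodule.sum_mem _ fun i _ => Submodule.smul_mem _ _ ?_)
    exact extVec_mem_extSub (Submodule.subset_span ⟨i, rfl⟩)
  obtain ⟨a, rfl⟩ := (Submodule.mem_span_range_iff_exists_fun F).1 hmem
  have hcoef : ∀ i : Fin (d + 1),
      algebraMap F K (a i) = k * (s 0 ^ (d - (i : ℕ)) * s 1 ^ (i : ℕ)) := by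
    intro i
    refine sub_eq_zero.1 (Fintype.linearIndependent_iff.1 (linearIndependent_extVec (K := K) hu)
      (fun i => algebraMap F K (a i) - k * (s 0 ^ (d - (i : ℕ)) * s 1 ^ (i : ℕ))) ?_ i)
    simp only [map_sum, extVec_smul, nrcVec, Finset.smul_sum, smul_smul] at h
    simp only [sub_smul, Finset.sum_sub_distrib, h, sub_self]
  have hk : k ≠ 0 := by
    rintro rfl
    exact extVec_ne_zero hv (by rw [h, zero_smul])
  by_cases hs0 : s 0 = 0
  · have hs1 : s 1 ≠ 0 := fun h1 => hs (by ext i; fin_cases i <;> simp [hs0, h1])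
    refine ⟨![0, 1], s 1, fun h => one_ne_zero (congrFun h 1), hs1, ?_⟩
    ext i
    fin_cases i <;> simp [hs0, extVec]
  · obtain ⟨m, rfl⟩ : ∃ m, d = m + 1 := ⟨d - 1, by omega⟩
    refine ⟨![1, a 1 / a 0], s 0, fun h => one_ne_zero (congrFun h 0), hs0, ?_⟩
    have h0 := hcoef 0
    have h1 := hcoef 1
    simp only [Fin.val_zero, Nat.sub_zero, pow_zero, mul_one, Fin.val_one, pow_one,
      Nat.add_sub_cancel] at h0 h1
    ext i
    fin_cases i
    · simp [extVec]
    · simp only [extVec, Fin.mk_one, LinearMap.coe_mk, AddHom.coe_mk, Pi.smul_apply,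
        Matrix.cons_val_one, Matrix.cons_val_fin_one, map_div₀, h0, h1, smul_eq_mul]
      field_simp
      ring

end Rational

/-! ### Images of projective planes -/

section Transfer

open Configuration

/-- The image of a finite projective plane under injective maps of points and lines that preserve
and reflect incidence is a subplane of the same order. -/
theorem isSubplaneOfOrder_range {P L P' L' : Type*} [Membership P L] [Membership P' L']
    [ProjectivePlane P L] [Finite P] [Finite L] {f : P → P'} {g : L → L'}
    (hf : Function.Injective f) (hg : Function.Injective g) (hfg : ∀ p l, f p ∈ g l ↔ p ∈ l) :
    IsSubplaneOfOrder L' (Set.range f) (ProjectivePlane.order P L) := by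
  let : Membership (Set.range f) (Set.range g) := ⟨fun l p => (p : P') ∈ (l : L')⟩
  let eP : P ≃ Set.range f := Equiv.ofInjective f hf
  let eL : L ≃ Set.range g := Equiv.ofInjective g hg
  have hmem : ∀ p l, eP p ∈ eL l ↔ p ∈ l := hfg
  have hmem' : ∀ (p : Set.range f) (l : Set.range g), p ∈ l ↔ eP.symm p ∈ eL.symm l := by
    intro p l
    rw [← hmem, Equiv.apply_symm_apply, Equiv.apply_symm_apply]
  let plane : ProjectivePlane (Set.range f) (Set.range g) :=
    { exists_point := fun l => by
        obtain ⟨p, hp⟩ := Nondegenerate.exists_point (P := P) (eL.symm l)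
        exact ⟨eP p, by rwa [hmem', Equiv.symm_apply_apply]⟩
      exists_line := fun p => by
        obtain ⟨l, hl⟩ := Nondegenerate.exists_line (L := L) (eP.symm p)
        exact ⟨eL l, by rwa [hmem', Equiv.symm_apply_apply]⟩
      eq_or_eq := fun {p q l m} h1 h2 h3 h4 => by
        rw [hmem'] at h1 h2 h3 h4
        exact (Nondegenerate.eq_or_eq h1 h2 h3 h4).imp (fun h => eP.symm.injective h)
          fun h => eL.symm.injective h
      mkPoint := fun {l m} h => eP (HasPoints.mkPoint (P := P) (eL.symm.injective.ne h))
      mkPoint_ax := fun {l m} h => by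
        rw [hmem', hmem', Equiv.symm_apply_apply]
        exact HasPoints.mkPoint_ax _
      mkLine := fun {p q} h => eL (HasLines.mkLine (L := L) (eP.symm.injective.ne h))
      mkLine_ax := fun {p q} h => by
        rw [hmem', hmem', Equiv.symm_apply_apply]
        exact HasLines.mkLine_ax _
      exists_config := by
        obtain ⟨p₁, p₂, p₃, l₁, l₂, l₃, h⟩ := @ProjectivePlane.exists_config P L _ _
        refine ⟨eP p₁, eP p₂, eP p₃, eL l₁, eL l₂, eL l₃, ?_⟩
        simpa only [hmem] using h }
  refine ⟨Set.range g, plane, ?_⟩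
  have := Fintype.ofFinite P
  have := Fintype.ofFinite (Set.range f)
  have h1 := ProjectivePlane.card_points P L
  have h2 := @ProjectivePlane.card_points (Set.range f) (Set.range g) _ plane _ _
  rw [← Fintype.card_congr eP, h1] at h2
  nlinarith

theorem order_projectivization (F : Type*) [Field F] [Fintype F] [DecidableEq F] :
    ProjectivePlane.order (ℙ F (Fin 3 → F)) (ℙ F (Fin 3 → F)) = Fintype.card F := by
  have := Fintype.ofFinite (ℙ F (Fin 3 → F))
  have h1 := ProjectivePlane.card_points (ℙ F (Fin 3 → F)) (ℙ F (Fin 3 → F))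
  have h2 := Projectivization.card_of_finrank F (Fin 3 → F) (n := 3) (by simp)
  rw [Nat.card_eq_fintype_card, h1] at h2
  simp only [Finset.sum_range_succ, Finset.sum_range_zero, Nat.card_eq_fintype_card] at h2
  nlinarith

end Transfer

/-! ### Coordinates for the Bruck–Bose plane -/

section PlaneSubspaces

variable {F : Type*} [Field F] {n : ℕ} {H : Submodule F (Fin n → F)}
  {S : Set (Submodule F (Fin n → F))}

/-- The subspace that represents a point of the Bruck–Bose plane. -/
def BBPoint.sub : BBPoint H S → Submodule F (Fin n → F)
  | .affine X _ => X.submodule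
  | .infinite σ _ => σ

/-- The subspace that represents a line of the Bruck–Bose plane; it is the hyperplane at infinity
for the line at infinity. -/
def BBLine.sub : BBLine H S → Submodule F (Fin n → F)
  | .affine l _ _ _ => l
  | .infinity => H

theorem BBPoint.sub_injective (hS : ∀ σ ∈ S, σ ≤ H) :
    Function.Injective (BBPoint.sub (H := H) (S := S)) := by
  rintro (⟨X, hX⟩ | ⟨σ, hσ⟩) (⟨Y, hY⟩ | ⟨τ, hτ⟩) h
  · obtain rfl := Projectivization.submodule_injective h
    rfl
  · exact absurd ((show X.submodule = τ from h) ▸ hS τ hτ) hX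
  · exact absurd ((show σ = Y.submodule from h) ▸ hS σ hσ) hY
  · obtain rfl : σ = τ := h
    rfl

theorem BBLine.sub_injective : Function.Injective (BBLine.sub (H := H) (S := S)) := by
  rintro (⟨l, h1, h2, h3⟩ | _) (⟨m, h1', h2', h3'⟩ | _) h
  · obtain rfl : l = m := h
    rfl
  · exact absurd (show l = H from h).le h2
  · exact absurd (show H = m from h).ge h2'
  · rfl

theorem bbMem_iff (hS : ∀ σ ∈ S, σ ≤ H) (X : BBPoint H S) (l : BBLine H S) :
    X ∈ l ↔ X.sub ≤ l.sub := by
  rcases X with ⟨X, hX⟩ | ⟨σ, hσ⟩ <;> rcases l with ⟨l, h1, h2, h3⟩ | _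
  · exact Iff.rfl
  · exact ⟨False.elim, hX⟩
  · exact Iff.rfl
  · exact ⟨fun _ => hS σ hσ, fun _ => trivial⟩

end PlaneSubspaces

section Coordinates

open Matrix

variable {F K : Type*} [Field F] [Field K] [Algebra F K]

/-- The inverse image of a `K`-subspace under an `F`-linear map, as an `F`-subspace. -/
def pullback {n : ℕ} (D : (Fin n → F) →ₗ[F] (Fin 3 → K)) (W : Submodule K (Fin 3 → K)) :
    Submodule F (Fin n → F) :=
  (W.restrictScalars F).comap D

/-- `D` identifies the vectors of the small space with the vectors of `K ^ 3` whose last coordinate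
lies in `F`, in such a way that `H` consists of the vectors with last coordinate `0`, and the
elements of `S` are the `K`-lines of such vectors. -/
structure IsPlaneCoordinates (H : Submodule F (Fin 7 → F)) (S : Set (Submodule F (Fin 7 → F)))
    (D : (Fin 7 → F) →ₗ[F] (Fin 3 → K)) : Prop where
  injective : Function.Injective D
  rational : ∀ v, ∃ a : F, D v 2 = algebraMap F K a
  surjective : ∀ (k : Fin 3 → K) (a : F), k 2 = algebraMap F K a → ∃ v, D v = k
  mem_iff : ∀ v, v ∈ H ↔ D v 2 = 0
  eq : S = {σ | ∃ k : Fin 3 → K, k ≠ 0 ∧ k 2 = 0 ∧ σ = pullback D (K ∙ k)}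

/-- The vectors orthogonal to a covector that represents a line of the projective plane. -/
def lineSub (l : ℙ K (Fin 3 → K)) : Submodule K (Fin 3 → K) where
  carrier := {x | x ⬝ᵥ l.rep = 0}
  zero_mem' := zero_dotProduct _
  add_mem' {x y} hx hy := by
    rw [Set.mem_ofPred_eq] at hx hy ⊢
    rw [add_dotProduct, hx, hy, add_zero]
  smul_mem' c x hx := by
    rw [Set.mem_ofPred_eq] at hx ⊢
    rw [smul_dotProduct, hx, smul_zero]

theorem mem_lineSub_mk {c : Fin 3 → K} (hc : c ≠ 0) (x : Fin 3 → K) :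
    x ∈ lineSub (Projectivization.mk K c hc) ↔ x ⬝ᵥ c = 0 := by
  obtain ⟨a, ha⟩ := Projectivization.exists_smul_eq_mk_rep K c hc
  change x ⬝ᵥ (Projectivization.mk K c hc).rep = 0 ↔ _
  rw [← ha, Units.smul_def, dotProduct_smul, smul_eq_mul, mul_eq_zero]
  exact or_iff_right a.ne_zero

theorem mem_iff_submodule_le_lineSub (p l : ℙ K (Fin 3 → K)) :
    p ∈ l ↔ p.submodule ≤ lineSub l := by
  induction p with
  | h x hx =>
    induction l with
    | h c hc =>
      rw [Configuration.ofField.mem_iff, Projectivization.orthogonal_mk,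
        Projectivization.submodule_mk, Submodule.span_singleton_le_iff_mem, mem_lineSub_mk]

theorem line_eq_of_forall_mem {E : Type*} [Field E] {l m : ℙ E (Fin 3 → E)}
    (h : ∀ p : ℙ E (Fin 3 → E), p ∈ l → p ∈ m) : l = m := by
  induction l with
  | h c hc =>
    induction m with
    | h d hd =>
      have hdot : ∀ x : Fin 3 → E, x ⬝ᵥ c = 0 → x ⬝ᵥ d = 0 := by
        intro x hx
        by_cases hx0 : x = 0
        · rw [hx0, zero_dotProduct]
        · exact h (Projectivization.mk E x hx0) hx
      rw [Projectivization.mk_eq_mk_iff_crossProduct_eq_zero]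
      -- the vectors orthogonal to `c` include the cross products of `c` with unit vectors
      have h0 := hdot ![0, c 2, - c 1] (by rw [dotProduct, Fin.sum_univ_three]; simp; ring)
      have h1 := hdot ![- c 2, 0, c 0] (by rw [dotProduct, Fin.sum_univ_three]; simp; ring)
      have h2 := hdot ![c 1, - c 0, 0] (by rw [dotProduct, Fin.sum_univ_three]; simp; ring)
      rw [dotProduct, Fin.sum_univ_three] at h0 h1 h2
      simp at h0 h1 h2
      ext i
      fin_cases i
      · simp [cross_apply]; linear_combination -h0
      · simp [cross_apply]; linear_combination -h1
      · simp [cross_apply]; linear_combination -h2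

theorem point_eq_of_forall_mem {E : Type*} [Field E] {p q : ℙ E (Fin 3 → E)}
    (h : ∀ l : ℙ E (Fin 3 → E), p ∈ l → q ∈ l) : p = q :=
  line_eq_of_forall_mem fun l hl =>
    Projectivization.orthogonal_comm.1 (h l (Projectivization.orthogonal_comm.1 hl))

namespace IsPlaneCoordinates

variable {H : Submodule F (Fin 7 → F)} {S : Set (Submodule F (Fin 7 → F))}
  {D : (Fin 7 → F) →ₗ[F] (Fin 3 → K)}

theorem le (hD : IsPlaneCoordinates H S D) : ∀ σ ∈ S, σ ≤ H := by
  intro σ hσ v hv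
  rw [hD.eq] at hσ
  obtain ⟨k, -, hk2, rfl⟩ := hσ
  obtain ⟨c, hc⟩ := Submodule.mem_span_singleton.1 (show D v ∈ K ∙ k from hv)
  rw [hD.mem_iff, ← hc, Pi.smul_apply, hk2, smul_zero]

theorem pullback_span_affine (hD : IsPlaneCoordinates H S D) {v : Fin 7 → F} (hv : v ∉ H) :
    pullback D (K ∙ D v) = F ∙ v := by
  refine le_antisymm (fun x hx => ?_) ?_
  · obtain ⟨c, hc⟩ := Submodule.mem_span_singleton.1 (show D x ∈ K ∙ D v from hx)
    obtain ⟨a, ha⟩ := hD.rational v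
    obtain ⟨b, hb⟩ := hD.rational x
    have ha0 : algebraMap F K a ≠ 0 := fun h => hv ((hD.mem_iff v).2 (ha.trans h))
    refine Submodule.mem_span_singleton.2 ⟨b / a, hD.injective ?_⟩
    rw [map_smul, ← hc, ← algebraMap_smul K (b / a) (D v), map_div₀, ← hb, ← ha, ← hc,
      Pi.smul_apply, smul_eq_mul, mul_div_assoc, div_self (ha ▸ ha0), mul_one]
  · rw [Submodule.span_singleton_le_iff_mem]
    exact Submodule.mem_span_singleton_self (D v)

theorem exists_submodule_eq_span (hD : IsPlaneCoordinates H S D) (p : ℙ K (Fin 3 → K)) :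
    ∃ v : Fin 7 → F, v ≠ 0 ∧ p.submodule = K ∙ D v := by
  have key : ∃ v : Fin 7 → F, p.submodule = K ∙ D v := by
    induction p with
    | h k hk =>
      rw [Projectivization.submodule_mk]
      by_cases h2 : k 2 = 0
      · obtain ⟨v, hv⟩ := hD.surjective k 0 (by rw [h2, map_zero])
        exact ⟨v, by rw [hv]⟩
      · obtain ⟨v, hv⟩ := hD.surjective ((k 2)⁻¹ • k) 1 (by simp [h2])
        exact ⟨v, by rw [hv, Submodule.span_singleton_smul_eq (IsUnit.mk0 _ (inv_ne_zero h2))]⟩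
  obtain ⟨v, hv⟩ := key
  refine ⟨v, ?_, hv⟩
  rintro rfl
  have := p.finrank_submodule
  rw [hv, map_zero, Submodule.span_zero_singleton, finrank_bot] at this
  exact zero_ne_one this

theorem pullback_le_iff (hD : IsPlaneCoordinates H S D) (p : ℙ K (Fin 3 → K))
    (W : Submodule K (Fin 3 → K)) : pullback D p.submodule ≤ pullback D W ↔ p.submodule ≤ W := by
  refine ⟨fun h => ?_, fun h v hv => h hv⟩
  obtain ⟨v, -, hv⟩ := hD.exists_submodule_eq_span p
  have : v ∈ pullback D W :=
    h (show D v ∈ p.submodule by rw [hv]; exact Submodule.mem_span_singleton_self _)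
  rw [hv, Submodule.span_singleton_le_iff_mem]
  exact this

theorem exists_bbPoint (hD : IsPlaneCoordinates H S D) (p : ℙ K (Fin 3 → K)) :
    ∃ X : BBPoint H S, X.sub = pullback D p.submodule := by
  obtain ⟨v, hv0, hv⟩ := hD.exists_submodule_eq_span p
  by_cases hvH : v ∈ H
  · refine ⟨.infinite (pullback D p.submodule) ?_, rfl⟩
    rw [hD.eq, hv]
    exact ⟨D v, fun h => hv0 (hD.injective (h.trans (map_zero D).symm)), (hD.mem_iff v).1 hvH, rfl⟩
  · refine ⟨.affine (Projectivization.mk F v hv0) ?_, ?_⟩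
    · rwa [Projectivization.submodule_mk, Submodule.span_singleton_le_iff_mem]
    · rw [hv, hD.pullback_span_affine hvH]
      exact Projectivization.submodule_mk v hv0

theorem exists_eq_bbPoint_sub (hD : IsPlaneCoordinates H S D) (X : BBPoint H S) :
    ∃ p : ℙ K (Fin 3 → K), X.sub = pullback D p.submodule := by
  rcases X with ⟨X, hX⟩ | ⟨σ, hσ⟩
  · induction X with
    | h v hv =>
      rw [Projectivization.submodule_mk, Submodule.span_singleton_le_iff_mem] at hX
      refine ⟨Projectivization.mk K (D v)
        fun h => hv (hD.injective (h.trans (map_zero D).symm)), ?_⟩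
      rw [Projectivization.submodule_mk, hD.pullback_span_affine hX]
      exact Projectivization.submodule_mk v hv
  · have hσ' := hσ
    rw [hD.eq] at hσ'
    obtain ⟨k, hk, -, h⟩ := hσ'
    exact ⟨Projectivization.mk K k hk, by rw [Projectivization.submodule_mk]; exact h⟩

theorem pullback_lineSub_of_eq_zero (hD : IsPlaneCoordinates H S D) {c : Fin 3 → K} (hc : c ≠ 0)
    (h0 : c 0 = 0) (h1 : c 1 = 0) : pullback D (lineSub (Projectivization.mk K c hc)) = H := by
  have h2 : c 2 ≠ 0 := fun h2 => hc (by ext i; fin_cases i <;> assumption)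
  ext v
  rw [hD.mem_iff]
  refine (mem_lineSub_mk hc (D v)).trans ?_
  rw [dotProduct, Fin.sum_univ_three, h0, h1, mul_zero, mul_zero, zero_add, zero_add, mul_eq_zero]
  exact or_iff_left h2

theorem finrank_pullback_lineSub (hK : Module.finrank F K = 3) (hD : IsPlaneCoordinates H S D)
    {c : Fin 3 → K} (hc : c ≠ 0) (h : ¬ (c 0 = 0 ∧ c 1 = 0)) :
    Module.finrank F (pullback D (lineSub (Projectivization.mk K c hc))) = 4 := by
  have : FiniteDimensional F K := Module.finite_of_finrank_pos (by omega)
  let ψ : (Fin 7 → F) →ₗ[F] K := ((dotProductBilin K K).flip c).restrictScalars F ∘ₗ D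
  have hψ : ∀ v, ψ v = D v ⬝ᵥ c := fun v => rfl
  have hker : pullback D (lineSub (Projectivization.mk K c hc)) = LinearMap.ker ψ := by
    ext v
    rw [LinearMap.mem_ker, hψ]
    exact mem_lineSub_mk hc (D v)
  have hrange : LinearMap.range ψ = ⊤ := by
    rw [LinearMap.range_eq_top]
    intro k
    by_cases h0 : c 0 = 0
    · have h1 : c 1 ≠ 0 := fun h1 => h ⟨h0, h1⟩
      obtain ⟨v, hv⟩ := hD.surjective ![0, k / c 1, 0] 0 (by simp)
      exact ⟨v, by rw [hψ, hv, dotProduct, Fin.sum_univ_three]; simp [h1]⟩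
    · obtain ⟨v, hv⟩ := hD.surjective ![k / c 0, 0, 0] 0 (by simp)
      exact ⟨v, by rw [hψ, hv, dotProduct, Fin.sum_univ_three]; simp [h0]⟩
  have := ψ.finrank_range_add_finrank_ker
  rw [hrange, finrank_top, hK, Module.finrank_fin_fun] at this
  rw [hker]
  omega

theorem exists_bbLine (hK : Module.finrank F K = 3) (hD : IsPlaneCoordinates H S D)
    (l : ℙ K (Fin 3 → K)) : ∃ m : BBLine H S, m.sub = pullback D (lineSub l) := by
  induction l with
  | h c hc =>
    by_cases h : c 0 = 0 ∧ c 1 = 0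
    · exact ⟨.infinity, (hD.pullback_lineSub_of_eq_zero hc h.1 h.2).symm⟩
    · refine ⟨.affine _ (hD.finrank_pullback_lineSub hK hc h) (fun hle => ?_) ?_, rfl⟩
      · have hv : ∃ k : Fin 3 → K, k 2 = 1 ∧ k ⬝ᵥ c = 0 := by
          by_cases h0 : c 0 = 0
          · have h1 : c 1 ≠ 0 := fun h1 => h ⟨h0, h1⟩
            exact ⟨![0, - c 2 / c 1, 1], rfl, by
              rw [dotProduct, Fin.sum_univ_three]; simp [h1]⟩
          · exact ⟨![- c 2 / c 0, 0, 1], rfl, by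
              rw [dotProduct, Fin.sum_univ_three]; simp [h0]⟩
        obtain ⟨k, hk2, hkc⟩ := hv
        obtain ⟨v, rfl⟩ := hD.surjective k 1 (by rw [hk2, map_one])
        have := (hD.mem_iff v).1 (hle ((mem_lineSub_mk hc (D v)).2 hkc))
        exact one_ne_zero (hk2.symm.trans this)
      · refine ⟨pullback D (K ∙ ![c 1, - c 0, 0]), ?_, fun v hv => ?_⟩
        · rw [hD.eq]
          refine ⟨_, fun h' => h ⟨?_, ?_⟩, rfl, rfl⟩
          · simpa using congrFun h' 1
          · simpa using congrFun h' 0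
        · refine (?_ : (K ∙ ![c 1, - c 0, 0]) ≤ lineSub (Projectivization.mk K c hc)) hv
          rw [Submodule.span_singleton_le_iff_mem, mem_lineSub_mk, dotProduct,
            Fin.sum_univ_three]
          simp only [cons_val_zero, cons_val_one, cons_val]
          ring

theorem exists_eq_bbLine_sub (hK : Module.finrank F K = 3) (hD : IsPlaneCoordinates H S D)
    (hS : ∀ σ ∈ S, Module.finrank F σ = 3) (m : BBLine H S) :
    ∃ l : ℙ K (Fin 3 → K), m.sub = pullback D (lineSub l) := by
  rcases m with ⟨m, hm, hmH, σ, hσ, hσm⟩ | _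
  · obtain ⟨v, hvm, hvH⟩ := SetLike.not_le_iff_exists.1 hmH
    have hσ' := hσ
    rw [hD.eq] at hσ'
    obtain ⟨k, hk0, hk2, hk⟩ := hσ'
    have hv2 : D v 2 ≠ 0 := fun h => hvH ((hD.mem_iff v).2 h)
    -- the line through the point `k` at infinity and the affine point `D v`
    let c : Fin 3 → K := crossProduct k (D v)
    have hc01 : ¬ (c 0 = 0 ∧ c 1 = 0) := by
      rintro ⟨h0, h1⟩
      simp only [c, cross_apply, cons_val_zero, cons_val_one, hk2, zero_mul, sub_zero, zero_sub,
        mul_eq_zero, hv2, or_false, neg_eq_zero] at h0 h1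
      exact hk0 (by ext i; fin_cases i <;> assumption)
    have hc : c ≠ 0 := fun h => hc01 ⟨congrFun h 0, congrFun h 1⟩
    refine ⟨Projectivization.mk K c hc, ?_⟩
    set W := pullback D (lineSub (Projectivization.mk K c hc)) with hW
    have hvW : v ∈ W := (mem_lineSub_mk hc (D v)).2 (dot_cross_self k (D v))
    have hσW : σ ≤ W := by
      rw [hk]
      intro x hx
      refine (?_ : (K ∙ k) ≤ lineSub (Projectivization.mk K c hc)) hx
      rw [Submodule.span_singleton_le_iff_mem, mem_lineSub_mk]
      exact dot_self_cross k (D v)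
    have hlt : σ < σ ⊔ F ∙ v := by
      refine lt_of_le_of_ne le_sup_left fun h => hvH (hD.le σ hσ ?_)
      rw [h]
      exact Submodule.mem_sup_right (Submodule.mem_span_singleton_self v)
    have h4 : 4 ≤ Module.finrank F (σ ⊔ F ∙ v : Submodule F (Fin 7 → F)) := by
      have := Submodule.finrank_lt_finrank_of_lt hlt
      rw [hS σ hσ] at this
      omega
    have e1 : σ ⊔ F ∙ v = m := Submodule.eq_of_le_of_finrank_le
      (sup_le hσm (by rwa [Submodule.span_singleton_le_iff_mem])) (hm.le.trans h4)
    have e2 : σ ⊔ F ∙ v = W := Submodule.eq_of_le_of_finrank_le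
      (sup_le hσW (by rwa [Submodule.span_singleton_le_iff_mem]))
      ((hD.finrank_pullback_lineSub hK hc hc01).le.trans h4)
    exact e1.symm.trans e2
  · exact ⟨Projectivization.mk K ![0, 0, 1] fun h => one_ne_zero (congrFun h 2),
      (hD.pullback_lineSub_of_eq_zero _ rfl rfl).symm⟩

theorem eq_of_pullback_lineSub_eq (hD : IsPlaneCoordinates H S D) {l m : ℙ K (Fin 3 → K)}
    (h : pullback D (lineSub l) = pullback D (lineSub m)) : l = m := by
  have hmem : ∀ p : ℙ K (Fin 3 → K), p ∈ l → p ∈ m := by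
    intro p hp
    rw [mem_iff_submodule_le_lineSub] at hp ⊢
    rw [← hD.pullback_le_iff, ← h, hD.pullback_le_iff]
    exact hp
  exact line_eq_of_forall_mem hmem

/-- The isomorphism of the projective plane over `K` with the Bruck–Bose plane: points and lines
correspond to the subspaces that `D` pulls back. -/
theorem exists_equivs (hK : Module.finrank F K = 3) (hD : IsPlaneCoordinates H S D)
    (hS : ∀ σ ∈ S, Module.finrank F σ = 3) :
    ∃ (eP : ℙ K (Fin 3 → K) ≃ BBPoint H S) (eL : ℙ K (Fin 3 → K) ≃ BBLine H S),
      (∀ p, (eP p).sub = pullback D p.submodule) ∧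
      (∀ l, (eL l).sub = pullback D (lineSub l)) ∧ ∀ p l, eP p ∈ eL l ↔ p ∈ l := by
  choose f hf using hD.exists_bbPoint
  choose g hg using hD.exists_bbLine hK
  have hfi : Function.Injective f := by
    intro p q hpq
    have h : pullback D p.submodule = pullback D q.submodule := by rw [← hf, ← hf, hpq]
    exact Projectivization.submodule_injective
      (le_antisymm ((hD.pullback_le_iff p _).1 h.le) ((hD.pullback_le_iff q _).1 h.ge))
  have hfs : Function.Surjective f := by
    intro X
    obtain ⟨p, hp⟩ := hD.exists_eq_bbPoint_sub X
    exact ⟨p, BBPoint.sub_injective hD.le ((hf p).trans hp.symm)⟩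
  have hgi : Function.Injective g := by
    intro l m hlm
    exact hD.eq_of_pullback_lineSub_eq (by rw [← hg, ← hg, hlm])
  have hgs : Function.Surjective g := by
    intro m
    obtain ⟨l, hl⟩ := hD.exists_eq_bbLine_sub hK hS m
    exact ⟨l, BBLine.sub_injective ((hg l).trans hl.symm)⟩
  refine ⟨Equiv.ofBijective f ⟨hfi, hfs⟩, Equiv.ofBijective g ⟨hgi, hgs⟩, hf, hg, fun p l => ?_⟩
  rw [bbMem_iff hD.le, mem_iff_submodule_le_lineSub, ← hD.pullback_le_iff p]
  change (f p).sub ≤ (g l).sub ↔ _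
  rw [hf, hg]

end IsPlaneCoordinates

end Coordinates

/-! ### Regular spreads -/

section RegularSpread

variable {F K : Type*} [Field F] [Field K] [Algebra F K] {n : ℕ}

/-- The map `k ↦ Tr(k x)` that parametrizes the spread element with transversal point `x`. -/
noncomputable def traceMap (x : Fin n → K) : K →ₗ[F] (Fin n → F) :=
  traceVec F K n ∘ₗ (LinearMap.toSpanSingleton K (Fin n → K) x).restrictScalars F

theorem traceMap_apply (x : Fin n → K) (k : K) : traceMap x k = traceVec F K n (k • x) := rfl

variable [Fintype F]

variable (F) in
/-- The `K`-span `⟨x, x^q, x^{q²}⟩` of a vector and its conjugates. -/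
def conjSpan (x : Fin n → K) : Submodule K (Fin n → K) :=
  (K ∙ x) ⊔ (K ∙ frobVec F K n x) ⊔ K ∙ frobVec F K n (frobVec F K n x)

theorem mem_conjSpan {x y : Fin n → K} : y ∈ conjSpan F x ↔ ∃ a b c : K,
    a • x + b • frobVec F K n x + c • frobVec F K n (frobVec F K n x) = y := by
  simp only [conjSpan, Submodule.mem_sup, Submodule.mem_span_singleton]
  constructor
  · rintro ⟨_, ⟨_, ⟨a, rfl⟩, _, ⟨b, rfl⟩, rfl⟩, _, ⟨c, rfl⟩, rfl⟩
    exact ⟨a, b, c, rfl⟩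
  · rintro ⟨a, b, c, rfl⟩
    exact ⟨_, ⟨_, ⟨a, rfl⟩, _, ⟨b, rfl⟩, rfl⟩, _, ⟨c, rfl⟩, rfl⟩

theorem conjSpan_eq_span (x : Fin n → K) : conjSpan F x = Submodule.span K
    (Set.range ![x, frobVec F K n x, frobVec F K n (frobVec F K n x)]) := by
  rw [conjSpan, ← Submodule.span_union, ← Submodule.span_union]
  congr 1
  ext y
  simp only [Set.mem_union, Set.mem_singleton_iff, Set.mem_range, Fin.exists_fin_succ,
    Matrix.cons_val_zero, Matrix.cons_val_succ, IsEmpty.exists_iff, or_false]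
  simp only [eq_comm, or_assoc]

theorem finrank_conjSpan_le (x : Fin n → K) : Module.finrank K (conjSpan F x) ≤ 3 := by
  rw [conjSpan_eq_span]
  exact (finrank_range_le_card _).trans (by simp)

namespace IsRegularSpread

variable {H : Submodule F (Fin n → F)} {S : Set (Submodule F (Fin n → F))}
  {g : Submodule K (Fin n → K)}

theorem comap_conjSpan_mem (hS : IsRegularSpread H S g) {x : Fin n → K} (hx : x ∈ g)
    (hx0 : x ≠ 0) : (conjSpan F x).comap (extVec F K n) ∈ S := by
  rw [hS.eq]
  have h0 := Projectivization.submodule_mk (K := K) x hx0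
  have h1 := frobPt_submodule (F := F) _ h0
  refine ⟨Projectivization.mk K x hx0, ?_, ?_⟩
  · rwa [h0, Submodule.span_singleton_le_iff_mem]
  · rw [frobPt_submodule _ h1, h1, h0, conjSpan]

theorem exists_eq_comap_conjSpan (hS : IsRegularSpread H S g) {σ : Submodule F (Fin n → F)}
    (hσ : σ ∈ S) : ∃ x ∈ g, x ≠ 0 ∧ σ = (conjSpan F x).comap (extVec F K n) := by
  rw [hS.eq] at hσ
  obtain ⟨P, hP, rfl⟩ := hσ
  induction P with
  | h x hx0 =>
    have h0 := Projectivization.submodule_mk (K := K) x hx0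
    have h1 := frobPt_submodule (F := F) _ h0
    refine ⟨x, ?_, hx0, ?_⟩
    · rwa [h0, Submodule.span_singleton_le_iff_mem] at hP
    · rw [frobPt_submodule _ h1, h1, h0, conjSpan]

theorem linearIndependent_conj (hS : IsRegularSpread H S g) {x : Fin n → K} (hx : x ∈ g)
    (hx0 : x ≠ 0) :
    LinearIndependent K ![x, frobVec F K n x, frobVec F K n (frobVec F K n x)] := by
  rw [linearIndependent_iff_card_le_finrank_span, Set.finrank, ← conjSpan_eq_span,
    Fintype.card_fin]
  exact (hS.isTwoSpread.finrank_eq _ (hS.comap_conjSpan_mem hx hx0)).ge.trans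
    (finrank_comap_extVec_le _)

theorem conj_coeff_eq_zero (hS : IsRegularSpread H S g) {x : Fin n → K} (hx : x ∈ g)
    (hx0 : x ≠ 0) {a b c : K}
    (h : a • x + b • frobVec F K n x + c • frobVec F K n (frobVec F K n x) = 0) :
    a = 0 ∧ b = 0 ∧ c = 0 := by
  have h' := Fintype.linearIndependent_iff.1 (hS.linearIndependent_conj hx hx0) ![a, b, c]
    (by rw [Fin.sum_univ_three]; exact h)
  exact ⟨h' 0, h' 1, h' 2⟩

theorem eq_zero_of_traceVec_eq_zero (hK : Module.finrank F K = 3) (hS : IsRegularSpread H S g)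
    {x : Fin n → K} (hx : x ∈ g) (h : traceVec F K n x = 0) : x = 0 := by
  by_contra hx0
  have h1 := extVec_traceVec hK x
  rw [h, map_zero] at h1
  refine one_ne_zero (hS.conj_coeff_eq_zero hx hx0 (a := 1) (b := 1) (c := 1) ?_).1
  rw [one_smul, one_smul, one_smul, ← h1]

theorem traceMap_injective (hK : Module.finrank F K = 3) (hS : IsRegularSpread H S g)
    {x : Fin n → K} (hx : x ∈ g) (hx0 : x ≠ 0) :
    Function.Injective (traceMap x : K →ₗ[F] (Fin n → F)) := by
  rw [← LinearMap.ker_eq_bot, LinearMap.ker_eq_bot']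
  intro k hk
  exact (smul_eq_zero.1 (hS.eq_zero_of_traceVec_eq_zero hK (g.smul_mem k hx) hk)).resolve_right hx0

/-- The spread element with transversal point `x` consists of the vectors `Tr(k x)`. -/
theorem comap_conjSpan_eq_range (hK : Module.finrank F K = 3) (hS : IsRegularSpread H S g)
    {x : Fin n → K} (hx : x ∈ g) (hx0 : x ≠ 0) :
    (conjSpan F x).comap (extVec F K n) = LinearMap.range (traceMap x : K →ₗ[F] (Fin n → F)) := by
  symm
  refine Submodule.eq_of_le_of_finrank_eq ?_ ?_
  · rintro _ ⟨k, rfl⟩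
    rw [Submodule.mem_comap, traceMap_apply, extVec_traceVec hK, mem_conjSpan, frobVec_smul,
      frobVec_smul]
    exact ⟨_, _, _, rfl⟩
  · rw [LinearMap.finrank_range_of_inj (hS.traceMap_injective hK hx hx0), hK,
      hS.isTwoSpread.finrank_eq _ (hS.comap_conjSpan_mem hx hx0)]

theorem range_traceMap_mem (hK : Module.finrank F K = 3) (hS : IsRegularSpread H S g)
    {x : Fin n → K} (hx : x ∈ g) (hx0 : x ≠ 0) :
    LinearMap.range (traceMap x : K →ₗ[F] (Fin n → F)) ∈ S :=
  hS.comap_conjSpan_eq_range hK hx hx0 ▸ hS.comap_conjSpan_mem hx hx0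

theorem exists_eq_range_traceMap (hK : Module.finrank F K = 3) (hS : IsRegularSpread H S g)
    {σ : Submodule F (Fin n → F)} (hσ : σ ∈ S) :
    ∃ x ∈ g, x ≠ 0 ∧ σ = LinearMap.range (traceMap x : K →ₗ[F] (Fin n → F)) := by
  obtain ⟨x, hx, hx0, h⟩ := hS.exists_eq_comap_conjSpan hσ
  exact ⟨x, hx, hx0, h.trans (hS.comap_conjSpan_eq_range hK hx hx0)⟩

theorem traceVec_mem (hK : Module.finrank F K = 3) (hS : IsRegularSpread H S g)
    {x : Fin n → K} (hx : x ∈ g) : traceVec F K n x ∈ H := by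
  by_cases hx0 : x = 0
  · rw [hx0, map_zero]
    exact H.zero_mem
  · refine hS.isTwoSpread.le _ (hS.range_traceMap_mem hK hx hx0) ⟨1, ?_⟩
    rw [traceMap_apply, one_smul]

/-- A transversal point `⟨x⟩` of a spread element determines that element and its extension. -/
theorem eq_of_submodule_eq (hK : Module.finrank F K = 3) (hS : IsRegularSpread H S g)
    {σ : Submodule F (Fin n → F)} (hσ : σ ∈ S) {x : Fin n → K} (hx0 : x ≠ 0)
    (hx : K ∙ x = extSub K σ ⊓ g) :
    x ∈ g ∧ σ = LinearMap.range (traceMap x : K →ₗ[F] (Fin n → F)) ∧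
      extSub K σ = conjSpan F x := by
  have hxg : x ∈ g := (hx ▸ Submodule.mem_span_singleton_self x : x ∈ extSub K σ ⊓ g).2
  obtain ⟨y, hy, hy0, hσy⟩ := hS.exists_eq_comap_conjSpan hσ
  have hle : extSub K σ ≤ conjSpan F y := by
    rw [hσy]
    refine Submodule.span_le.2 ?_
    rintro _ ⟨v, hv, rfl⟩
    exact hv
  have heq : extSub K σ = conjSpan F y := by
    refine Submodule.eq_of_le_of_finrank_le hle ?_
    rw [finrank_extSub, hS.isTwoSpread.finrank_eq _ hσ]
    exact finrank_conjSpan_le y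
  have hyx : y ∈ K ∙ x := by
    rw [hx, heq]
    exact ⟨mem_conjSpan.2 ⟨1, 0, 0, by simp⟩, hy⟩
  obtain ⟨c, rfl⟩ := Submodule.mem_span_singleton.1 hyx
  have hc : c ≠ 0 := fun hc => hy0 (by rw [hc, zero_smul])
  have hconj : conjSpan F (c • x) = conjSpan F x := by
    have hφ : ∀ a : K, a ≠ 0 → FiniteField.frobeniusAlgHom F K a ≠ 0 := fun a ha =>
      (map_ne_zero_iff _ (FiniteField.frobeniusAlgHom F K : K →+* K).injective).2 ha
    rw [conjSpan, frobVec_smul, frobVec_smul,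
      Submodule.span_singleton_smul_eq (IsUnit.mk0 _ hc),
      Submodule.span_singleton_smul_eq (IsUnit.mk0 _ (hφ _ hc)),
      Submodule.span_singleton_smul_eq (IsUnit.mk0 _ (hφ _ (hφ _ hc))), conjSpan]
  rw [hconj] at hσy heq
  exact ⟨hxg, hσy.trans (hS.comap_conjSpan_eq_range hK hxg hx0), heq⟩

/-- Two different spread elements meet only in the zero vector. -/
theorem inf_eq_bot (hS : IsRegularSpread H S g) {σ τ : Submodule F (Fin n → F)} (hσ : σ ∈ S)
    (hτ : τ ∈ S) (h : σ ≠ τ) : σ ⊓ τ = ⊥ := by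
  rw [Submodule.eq_bot_iff]
  rintro v ⟨hvσ, hvτ⟩
  by_contra hv0
  have hle : ∀ {U : Submodule F (Fin n → F)}, v ∈ U →
      (Projectivization.mk F v hv0).submodule ≤ U := by
    intro U hU
    rwa [Projectivization.submodule_mk, Submodule.span_singleton_le_iff_mem]
  exact h ((hS.isTwoSpread.existsUnique _ (hle (hS.isTwoSpread.le σ hσ hvσ))).unique
    ⟨hσ, hle hvσ⟩ ⟨hτ, hle hvτ⟩)

/-- A vector outside `H` and a basis of the transversal line give coordinates for the Bruck–Bose
plane. -/
theorem exists_planeCoordinates {H : Submodule F (Fin 7 → F)}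
    {S : Set (Submodule F (Fin 7 → F))} {g : Submodule K (Fin 7 → K)}
    (hK : Module.finrank F K = 3) (hS : IsRegularSpread H S g) {p r : Fin 7 → K}
    (hp : p ∈ g) (hr : r ∈ g) (hpr : LinearIndependent K ![p, r]) {e : Fin 7 → F} (he : e ∉ H) :
    ∃ D : (Fin 7 → F) →ₗ[F] (Fin 3 → K), IsPlaneCoordinates H S D ∧
      ∀ (x y : K) (z : F),
        D (traceVec F K 7 (x • p + y • r) + z • e) = ![x, y, algebraMap F K z] := by
  have : FiniteDimensional F K := Module.finite_of_finrank_pos (by omega)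
  have hg : ∀ v ∈ g, ∃ x y : K, x • p + y • r = v := by
    have hspan : Submodule.span K {p, r} = g := by
      refine Submodule.eq_of_le_of_finrank_eq ?_ ?_
      · rw [Submodule.span_le]
        rintro _ (rfl | rfl) <;> assumption
      · have := finrank_span_eq_card hpr
        rw [Matrix.range_cons, Matrix.range_cons, Matrix.range_empty, Set.union_empty,
          Set.singleton_union] at this
        rw [this, hS.finrank_eq, Fintype.card_fin]
    intro v hv
    rw [← hspan] at hv
    exact Submodule.mem_span_pair.1 hv
  have hmem : ∀ x y : K, x • p + y • r ∈ g := fun x y =>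
    g.add_mem (g.smul_mem x hp) (g.smul_mem y hr)
  let Ψ₀ : (K × K × F) →ₗ[F] (Fin 7 → F) :=
    { toFun := fun k => traceVec F K 7 (k.1 • p + k.2.1 • r) + k.2.2 • e
      map_add' := fun k l => by
        simp only [Prod.fst_add, Prod.snd_add, add_smul, map_add]
        abel
      map_smul' := fun c k => by
        simp only [Prod.smul_fst, Prod.smul_snd, smul_assoc, RingHom.id_apply, ← smul_add,
          map_smul] }
  have hΨH : ∀ k, Ψ₀ k ∈ H ↔ k.2.2 = 0 := by
    intro k
    change traceVec F K 7 (k.1 • p + k.2.1 • r) + k.2.2 • e ∈ H ↔ _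
    rw [H.add_mem_iff_right (hS.traceVec_mem hK (hmem _ _))]
    refine ⟨fun h => ?_, fun h => by rw [h, zero_smul]; exact H.zero_mem⟩
    by_contra h0
    exact he ((H.smul_mem_iff h0).1 h)
  have hinj : Function.Injective Ψ₀ := by
    rw [← LinearMap.ker_eq_bot, LinearMap.ker_eq_bot']
    rintro ⟨x, y, z⟩ h
    have hz : z = 0 := (hΨH (x, y, z)).1 (h ▸ H.zero_mem)
    subst hz
    change traceVec F K 7 (x • p + y • r) + (0 : F) • e = 0 at h
    rw [zero_smul, add_zero] at h
    have h0 := hS.eq_zero_of_traceVec_eq_zero hK (hmem x y) h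
    obtain ⟨rfl, rfl⟩ := LinearIndependent.pair_iff.1 hpr x y h0
    rfl
  have hsurj : Function.Surjective Ψ₀ :=
    (LinearMap.injective_iff_surjective_of_finrank_eq_finrank (by
      rw [Module.finrank_prod, Module.finrank_prod, hK, Module.finrank_self,
        Module.finrank_fin_fun])).1 hinj
  let Ψ := LinearEquiv.ofBijective Ψ₀ ⟨hinj, hsurj⟩
  let ι : (K × K × F) →ₗ[F] (Fin 3 → K) :=
    { toFun := fun k => ![k.1, k.2.1, algebraMap F K k.2.2]
      map_add' := fun k l => by ext i; fin_cases i <;> simp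
      map_smul' := fun c k => by ext i; fin_cases i <;> simp [Algebra.smul_def] }
  have hD : ∀ x y z, (ι ∘ₗ Ψ.symm.toLinearMap) (traceVec F K 7 (x • p + y • r) + z • e) =
      ![x, y, algebraMap F K z] := by
    intro x y z
    have : Ψ.symm (traceVec F K 7 (x • p + y • r) + z • e) = (x, y, z) :=
      Ψ.symm_apply_eq.2 rfl
    change ι (Ψ.symm _) = _
    rw [this]
    rfl
  have hex : ∀ v, ∃ x y z, traceVec F K 7 (x • p + y • r) + z • e = v := fun v =>
    have ⟨⟨x, y, z⟩, h⟩ := hsurj v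
    ⟨x, y, z, h⟩
  refine ⟨ι ∘ₗ Ψ.symm.toLinearMap, ?_, hD⟩
  generalize ι ∘ₗ Ψ.symm.toLinearMap = D at hD
  refine ⟨fun v v' h => ?_, fun v => ?_, fun k a hk => ?_, fun v => ?_, Set.ext fun σ => ?_⟩
  · obtain ⟨x, y, z, rfl⟩ := hex v
    obtain ⟨x', y', z', rfl⟩ := hex v'
    rw [hD, hD] at h
    have h0 : x = x' := congrFun h 0
    have h1 : y = y' := congrFun h 1
    have h2 : z = z' := (algebraMap F K).injective (congrFun h 2)
    rw [h0, h1, h2]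
  · obtain ⟨x, y, z, rfl⟩ := hex v
    exact ⟨z, by rw [hD]; rfl⟩
  · refine ⟨_, (hD (k 0) (k 1) a).trans ?_⟩
    ext i
    fin_cases i
    · rfl
    · rfl
    · exact hk.symm
  · obtain ⟨x, y, z, rfl⟩ := hex v
    rw [hD]
    refine (hΨH (x, y, z)).trans ?_
    exact (map_eq_zero_iff _ (algebraMap F K).injective).symm
  · have key : ∀ x y : K, LinearMap.range (traceMap (x • p + y • r) : K →ₗ[F] (Fin 7 → F)) =
        pullback D (K ∙ ![x, y, 0]) := by
      intro x y
      have hD' : ∀ c : K, D (traceMap (x • p + y • r) c) = c • ![x, y, 0] := by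
        intro c
        have := hD (c * x) (c * y) 0
        rw [zero_smul, add_zero, mul_smul, mul_smul, ← smul_add, map_zero] at this
        rw [traceMap_apply, this]
        simp
      refine le_antisymm ?_ fun v hv => ?_
      · rintro _ ⟨c, rfl⟩
        exact Submodule.mem_span_singleton.2 ⟨c, (hD' c).symm⟩
      · obtain ⟨c, hc⟩ := Submodule.mem_span_singleton.1 (show D v ∈ K ∙ ![x, y, 0] from hv)
        obtain ⟨x', y', z', rfl⟩ := hex v
        rw [hD] at hc
        have h0 : c * x = x' := congrFun hc 0
        have h1 : c * y = y' := congrFun hc 1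
        have h2 : c * 0 = algebraMap F K z' := congrFun hc 2
        rw [mul_zero, eq_comm, map_eq_zero_iff _ (algebraMap F K).injective] at h2
        refine ⟨c, ?_⟩
        rw [traceMap_apply, h2, ← h0, ← h1, zero_smul, add_zero, mul_smul, mul_smul, smul_add]
    constructor
    · intro hσ
      obtain ⟨v, hv, hv0, rfl⟩ := hS.exists_eq_range_traceMap hK hσ
      obtain ⟨x, y, rfl⟩ := hg v hv
      refine ⟨![x, y, 0], fun h => hv0 ?_, rfl, key x y⟩
      have h0 : x = 0 := congrFun h 0
      have h1 : y = 0 := congrFun h 1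
      rw [h0, h1, zero_smul, zero_smul, add_zero]
    · rintro ⟨k, hk0, hk2, rfl⟩
      have hk : k = ![k 0, k 1, 0] := by
        ext i
        fin_cases i
        · rfl
        · rfl
        · exact hk2
      rw [hk, ← key]
      refine hS.range_traceMap_mem hK (hmem _ _) fun h => hk0 ?_
      obtain ⟨h0, h1⟩ := LinearIndependent.pair_iff.1 hpr _ _ h
      rw [hk, h0, h1]
      simp

end IsRegularSpread

end RegularSpread

/-! ### Conics through three conjugate points -/

section Quadratic

variable {F : Type*} [Field F] {n : ℕ}

/-- A homogeneous polynomial of degree `2` is the quadratic form of a (not necessarily symmetric)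
bilinear form. -/
theorem exists_coeff_of_isHomogeneous_two {f : MvPolynomial (Fin n) F} (hf : f.IsHomogeneous 2) :
    ∃ c : Fin n → Fin n → F, f = ∑ i, ∑ j,
      MvPolynomial.C (c i j) * (MvPolynomial.X i * MvPolynomial.X j) := by
  have hmem : f ∈ MvPolynomial.homogeneousSubmodule (Fin n) F 1 *
      MvPolynomial.homogeneousSubmodule (Fin n) F 1 := by
    rw [← pow_two, MvPolynomial.homogeneousSubmodule_one_pow]
    exact hf
  clear hf
  have hlin : ∀ g ∈ MvPolynomial.homogeneousSubmodule (Fin n) F 1, ∃ a : Fin n → F,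
      g = ∑ i, MvPolynomial.C (a i) * MvPolynomial.X i := by
    intro g hg
    rw [MvPolynomial.homogeneousSubmodule_one_eq_span_X] at hg
    obtain ⟨a, rfl⟩ := (Submodule.mem_span_range_iff_exists_fun F).1 hg
    exact ⟨a, by simp only [MvPolynomial.smul_eq_C_mul]⟩
  induction hmem using Submodule.mul_induction_on' with
  | mem_mul_mem g hg h hh =>
    obtain ⟨a, rfl⟩ := hlin g hg
    obtain ⟨b, rfl⟩ := hlin h hh
    refine ⟨fun i j => a i * b j, ?_⟩
    rw [Finset.sum_mul_sum]
    refine Finset.sum_congr rfl fun i _ => Finset.sum_congr rfl fun j _ => ?_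
    rw [map_mul]
    ring
  | add g _ h _ hg hh =>
    obtain ⟨a, rfl⟩ := hg
    obtain ⟨b, rfl⟩ := hh
    refine ⟨fun i j => a i j + b i j, ?_⟩
    simp only [map_add, add_mul, Finset.sum_add_distrib]

theorem exists_bilinear_of_isHomogeneous_two {K : Type*} [Field K] [Algebra F K] [Fintype F]
    {f : MvPolynomial (Fin n) F} (hf : f.IsHomogeneous 2) :
    ∃ B : (Fin n → K) →ₗ[K] (Fin n → K) →ₗ[K] K, (∀ v, MvPolynomial.aeval v f = B v v) ∧
      ∀ v w, B (frobVec F K n v) (frobVec F K n w) =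
        FiniteField.frobeniusAlgHom F K (B v w) := by
  obtain ⟨c, rfl⟩ := exists_coeff_of_isHomogeneous_two hf
  have hB : ∀ v w : Fin n → K,
      Matrix.toLinearMap₂' K (Matrix.of fun i j => algebraMap F K (c i j)) v w =
        ∑ i, ∑ j, algebraMap F K (c i j) * (v i * w j) := by
    intro v w
    rw [Matrix.toLinearMap₂'_apply]
    refine Finset.sum_congr rfl fun i _ => Finset.sum_congr rfl fun j _ => ?_
    simp only [smul_eq_mul, Matrix.of_apply]
    ring
  refine ⟨Matrix.toLinearMap₂' K (Matrix.of fun i j => algebraMap F K (c i j)), fun v => ?_,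
    fun v w => ?_⟩
  · simp only [hB, map_sum, map_mul, MvPolynomial.aeval_C, MvPolynomial.aeval_X]
  · simp only [hB, map_sum, map_mul, frob_algebraMap]
    rfl

theorem aeval_extVec {K : Type*} [Field K] [Algebra F K] (f : MvPolynomial (Fin n) F)
    (v : Fin n → F) :
    MvPolynomial.aeval (extVec F K n v) f = algebraMap F K (MvPolynomial.aeval v f) :=
  MvPolynomial.aeval_algebraMap_apply K v f

theorem mem_conic_mk {E : Type*} [Field E] [Algebra F E] {U : Submodule E (Fin n → E)}
    {f : MvPolynomial (Fin n) F} (hf : f.IsHomogeneous 2) {v : Fin n → E} (hv : v ≠ 0) :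
    Projectivization.mk E v hv ∈ conic E U f ↔ v ∈ U ∧ MvPolynomial.aeval v f = 0 := by
  simp only [conic, Set.mem_ofPred_eq, Projectivization.submodule_mk,
    Submodule.span_singleton_le_iff_mem]
  refine and_congr_right fun _ => ⟨fun h => h v (Submodule.mem_span_singleton_self v), ?_⟩
  intro h x hx
  obtain ⟨k, rfl⟩ := Submodule.mem_span_singleton.1 hx
  obtain ⟨c, rfl⟩ := exists_coeff_of_isHomogeneous_two hf
  simp only [map_sum, map_mul, MvPolynomial.aeval_C, MvPolynomial.aeval_X] at h ⊢
  rw [← mul_zero (k ^ 2), ← h, Finset.mul_sum]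
  refine Finset.sum_congr rfl fun i _ => ?_
  rw [Finset.mul_sum]
  refine Finset.sum_congr rfl fun j _ => ?_
  simp only [Pi.smul_apply, smul_eq_mul]
  ring

end Quadratic


section LowDegree

variable {E V : Type*} [Field E] [AddCommGroup V] [Module E V]

theorem nrcVec_two (w : Fin 3 → V) (s : Fin 2 → E) :
    nrcVec (d := 2) w s = s 0 ^ 2 • w 0 + (s 0 * s 1) • w 1 + s 1 ^ 2 • w 2 := by
  refine (Fin.sum_univ_three _).trans ?_
  simp

theorem nrcVec_three (w : Fin 4 → V) (s : Fin 2 → E) :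
    nrcVec (d := 3) w s =
      s 0 ^ 3 • w 0 + (s 0 ^ 2 * s 1) • w 1 + (s 0 * s 1 ^ 2) • w 2 + s 1 ^ 3 • w 3 := by
  refine (Fin.sum_univ_four _).trans ?_
  simp

end LowDegree

section Conjugates

variable {F K : Type*} [Field F] [Fintype F] [Field K] [Algebra F K] {n : ℕ}

local notation "φ" => FiniteField.frobeniusAlgHom F K

theorem frob_injective : Function.Injective φ :=
  (FiniteField.frobeniusAlgHom F K : K →+* K).injective

theorem frob_frob_ne (hK : Module.finrank F K = 3) {θ : K} (hθ : φ θ ≠ θ) : φ (φ θ) ≠ θ := by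
  intro h
  have := frob_frob_frob hK θ
  rw [h] at this
  exact hθ this

/-- Let `f` vanish at `p` and its conjugates, but not on the whole span of these vectors. Then `f`
takes the following form in the coordinates with respect to a scalar multiple of `p` and its
conjugates. The coefficients are chosen such that `∑ βᵢ = ∑ βᵢ θᵢ = 0`. -/
theorem exists_conic_normal_form (hK : Module.finrank F K = 3) {θ : K} (hθ : φ θ ≠ θ)
    {f : MvPolynomial (Fin n) F} (hf : f.IsHomogeneous 2) {p : Fin n → K}
    (hp : MvPolynomial.aeval p f = 0)
    (hne : ∃ x ∈ conjSpan F p, MvPolynomial.aeval x f ≠ 0) :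
    ∃ b c : K, b ≠ 0 ∧ c ≠ 0 ∧ ∀ x y z : K,
      MvPolynomial.aeval (x • (b • p) + y • frobVec F K n (b • p) +
        z • frobVec F K n (frobVec F K n (b • p))) f =
      c * ((φ (φ θ) - φ θ) * (y * z) + (θ - φ (φ θ)) * (x * z) + (φ θ - θ) * (x * y)) := by
  obtain ⟨B, hB, hBφ⟩ := exists_bilinear_of_isHomogeneous_two (K := K) hf
  set p₁ := frobVec F K n p with hp₁
  set p₂ := frobVec F K n p₁ with hp₂
  have hp₃ : frobVec F K n p₂ = p := frobVec_frobVec_frobVec hK p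
  have h00 : B p p = 0 := by rw [← hB, hp]
  have h11 : B p₁ p₁ = 0 := by rw [hp₁, hBφ, h00, map_zero]
  have h22 : B p₂ p₂ = 0 := by rw [hp₂, hBφ, h11, map_zero]
  set a := B p₁ p₂ + B p₂ p₁ with ha
  have ha₁ : φ a = B p₂ p + B p p₂ := by rw [ha, map_add, ← hBφ, ← hBφ, hp₃, ← hp₂]
  have ha₂ : φ (φ a) = B p p₁ + B p₁ p := by rw [ha₁, map_add, ← hBφ, ← hBφ, hp₃, ← hp₁]
  have hform : ∀ x y z : K, MvPolynomial.aeval (x • p + y • p₁ + z • p₂) f =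
      a * (y * z) + φ a * (x * z) + φ (φ a) * (x * y) := by
    intro x y z
    rw [hB, ha₂, ha₁, ha]
    simp only [map_add, LinearMap.add_apply, map_smul, LinearMap.smul_apply, smul_eq_mul, h00,
      h11, h22]
    ring
  have ha0 : a ≠ 0 := by
    intro ha0
    obtain ⟨v, hv, hv0⟩ := hne
    obtain ⟨x, y, z, rfl⟩ := mem_conjSpan.1 hv
    refine hv0 ((hform x y z).trans ?_)
    rw [ha0, map_zero, map_zero]
    ring
  have hβ : φ (φ θ) - φ θ ≠ 0 := sub_ne_zero.2 fun h => hθ (frob_injective h)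
  set β := φ (φ θ) - φ θ with hβdef
  have hβ₁ : φ β = θ - φ (φ θ) := by rw [hβdef, map_sub, frob_frob_frob hK]
  have hβ₂ : φ (φ β) = φ θ - θ := by rw [hβ₁, map_sub, frob_frob_frob hK]
  obtain ⟨b, hb⟩ : ∃ b, a = b * β := ⟨a / β, (div_mul_cancel₀ a hβ).symm⟩
  have hb0 : b ≠ 0 := fun h => ha0 (by rw [hb, h, zero_mul])
  have hφ0 : ∀ {k : K}, k ≠ 0 → φ k ≠ 0 := fun hk => (map_ne_zero_iff _ frob_injective).2 hk
  refine ⟨b, b * φ b * φ (φ b), hb0, mul_ne_zero (mul_ne_zero hb0 (hφ0 hb0)) (hφ0 (hφ0 hb0)),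
    fun x y z => ?_⟩
  rw [frobVec_smul, frobVec_smul, smul_smul, smul_smul, smul_smul, ← hp₁, ← hp₂, hform, hb]
  simp only [map_mul, hβ₂, ← hβ₁]
  ring

/-- The linear form `s₀ - θ s₁`, which vanishes at the point `(θ : 1)` of the projective line. -/
def linForm (θ : K) (s : Fin 2 → K) : K := s 0 - θ * s 1

/-- The point with parameter `s` of the conic `∑ βᵢ XⱼXₖ = 0`, where `∑ βᵢ Lᵢ = 0`. -/
def conicVec (F : Type*) [Field F] [Fintype F] [Algebra F K] (θ : K) (p : Fin n → K)
    (s : Fin 2 → K) : Fin n → K :=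
  (linForm (FiniteField.frobeniusAlgHom F K θ) s *
      linForm (FiniteField.frobeniusAlgHom F K (FiniteField.frobeniusAlgHom F K θ)) s) • p +
    (linForm θ s *
      linForm (FiniteField.frobeniusAlgHom F K (FiniteField.frobeniusAlgHom F K θ)) s) •
        frobVec F K n p +
    (linForm θ s * linForm (FiniteField.frobeniusAlgHom F K θ) s) •
      frobVec F K n (frobVec F K n p)

/-- A frame over `F` of the conic parametrized by `conicVec`. -/
noncomputable def conicFrame (F : Type*) [Field F] [Fintype F] [Algebra F K] (θ : K)
    (p : Fin n → K) : Fin 3 → Fin n → F :=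
  ![traceMap p 1,
    - traceMap p (FiniteField.frobeniusAlgHom F K θ +
      FiniteField.frobeniusAlgHom F K (FiniteField.frobeniusAlgHom F K θ)),
    traceMap p (FiniteField.frobeniusAlgHom F K θ *
      FiniteField.frobeniusAlgHom F K (FiniteField.frobeniusAlgHom F K θ))]

theorem nrcVec_conicFrame (hK : Module.finrank F K = 3) (θ : K) (p : Fin n → K)
    (s : Fin 2 → K) :
    nrcVec (d := 2) (fun j => extVec F K n (conicFrame F θ p j)) s = conicVec F θ p s := by
  simp only [nrcVec_two, conicFrame, Matrix.cons_val_zero, Matrix.cons_val_one,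
    Matrix.cons_val, map_neg, traceMap_apply, extVec_traceVec hK, frobVec_smul, map_add, map_mul,
    frob_frob_frob hK, map_one, conicVec, linForm]
  ext m
  simp only [Pi.add_apply, Pi.smul_apply, Pi.neg_apply, smul_eq_mul]
  ring

theorem nrcVec_conicFrame_rational (θ : K) (p : Fin n → K) (t : Fin 2 → F) :
    nrcVec (d := 2) (conicFrame F θ p) t =
      traceMap p (linForm (φ θ) (extVec F K 2 t) * linForm (φ (φ θ)) (extVec F K 2 t)) := by
  have h : linForm (φ θ) (extVec F K 2 t) * linForm (φ (φ θ)) (extVec F K 2 t) =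
      (t 0 ^ 2) • (1 : K) - (t 0 * t 1) • (φ θ + φ (φ θ)) +
        (t 1 ^ 2) • (φ θ * φ (φ θ)) := by
    simp only [linForm, extVec, LinearMap.coe_mk, AddHom.coe_mk, Algebra.smul_def, map_mul,
      map_pow]
    ring
  rw [h, map_add, map_sub, map_smul, map_smul, map_smul]
  simp only [nrcVec_two, conicFrame, Matrix.cons_val_zero, Matrix.cons_val_one,
    Matrix.cons_val, smul_neg, sub_eq_add_neg]

theorem linearIndependent_conicFrame (hK : Module.finrank F K = 3) {θ : K} (hθ : φ θ ≠ θ)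
    {p : Fin n → K} (hp : Function.Injective (traceMap p : K →ₗ[F] (Fin n → F))) :
    LinearIndependent F (conicFrame F θ p) := by
  rw [Fintype.linearIndependent_iff]
  intro a ha
  have h0 : traceMap p (a 0 • (1 : K) - a 1 • (φ θ + φ (φ θ)) + a 2 • (φ θ * φ (φ θ))) =
      (0 : Fin n → F) := by
    rw [map_add, map_sub, map_smul, map_smul, map_smul, ← ha]
    simp only [conicFrame, Fin.sum_univ_three, Matrix.cons_val_zero, Matrix.cons_val_one,
      Matrix.cons_val, smul_neg, sub_eq_add_neg]
  have h1 := hp (h0.trans (map_zero _).symm)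
  -- the conjugates of a relation between `1`, `θ₁ + θ₂`, `θ₁ θ₂` show that it is trivial
  have h2 := congrArg (fun k => φ k) h1
  have h3 := congrArg (fun k => φ k) h2
  simp only [Algebra.smul_def, map_add, map_sub, map_mul, map_zero, frob_algebraMap,
    frob_frob_frob hK, mul_one] at h1 h2 h3
  have n01 : φ θ - θ ≠ 0 := sub_ne_zero.2 hθ
  have n02 : φ (φ θ) - θ ≠ 0 := sub_ne_zero.2 (frob_frob_ne hK hθ)
  have n12 : φ (φ θ) - φ θ ≠ 0 := sub_ne_zero.2 fun h => hθ (frob_injective h)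
  generalize φ (φ θ) = θ₂ at *
  generalize φ θ = θ₁ at *
  have e1 : - algebraMap F K (a 1) + algebraMap F K (a 2) * θ₂ = 0 := by
    refine (mul_eq_zero.1 (?_ : (θ₁ - θ) * _ = 0)).resolve_left n01
    linear_combination h1 - h2
  have e2 : - algebraMap F K (a 1) + algebraMap F K (a 2) * θ = 0 := by
    refine (mul_eq_zero.1 (?_ : (θ₂ - θ₁) * _ = 0)).resolve_left n12
    linear_combination h2 - h3
  have e3 : algebraMap F K (a 2) = 0 := by
    refine (mul_eq_zero.1 (?_ : (θ₂ - θ) * _ = 0)).resolve_left n02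
    linear_combination e1 - e2
  have e4 : algebraMap F K (a 1) = 0 := by linear_combination θ * e3 - e2
  have e5 : algebraMap F K (a 0) = 0 := by
    linear_combination h1 + (θ₁ + θ₂) * e4 - θ₁ * θ₂ * e3
  intro i
  refine (algebraMap F K).injective ?_
  rw [map_zero]
  fin_cases i <;> assumption

theorem exists_linForm_eq {θ₀ θ₁ : K} (h : θ₁ ≠ θ₀) (x y : K) :
    ∃ s : Fin 2 → K, linForm θ₀ s = x ∧ linForm θ₁ s = y := by
  have : θ₁ - θ₀ ≠ 0 := sub_ne_zero.2 h
  refine ⟨![(θ₁ * x - θ₀ * y) / (θ₁ - θ₀), (x - y) / (θ₁ - θ₀)], ?_, ?_⟩ <;>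
  · simp only [linForm, Matrix.cons_val_zero, Matrix.cons_val_one]
    field_simp
    ring

/-- The points of the conic `∑ βᵢ XⱼXₖ = 0` are those parametrized by `conicVec`. -/
theorem exists_conicVec_eq (hK : Module.finrank F K = 3) {θ : K} (hθ : φ θ ≠ θ)
    {p : Fin n → K} {x y z : K} (hxyz : ¬ (x = 0 ∧ y = 0 ∧ z = 0))
    (h : (φ (φ θ) - φ θ) * (y * z) + (θ - φ (φ θ)) * (x * z) + (φ θ - θ) * (x * y) = 0) :
    ∃ (s : Fin 2 → K) (k : K), s ≠ 0 ∧ k ≠ 0 ∧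
      k • (x • p + y • frobVec F K n p + z • frobVec F K n (frobVec F K n p)) =
        conicVec F θ p s := by
  have n01 : φ θ - θ ≠ 0 := sub_ne_zero.2 hθ
  have n02 : φ (φ θ) - θ ≠ 0 := sub_ne_zero.2 (frob_frob_ne hK hθ)
  have n12 : φ (φ θ) - φ θ ≠ 0 := sub_ne_zero.2 fun h => hθ (frob_injective h)
  -- it is enough to make the coordinates of the two points proportional
  suffices ∃ (s : Fin 2 → K) (k : K), s ≠ 0 ∧ k ≠ 0 ∧
      k * x = linForm (φ θ) s * linForm (φ (φ θ)) s ∧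
      k * y = linForm θ s * linForm (φ (φ θ)) s ∧ k * z = linForm θ s * linForm (φ θ) s by
    obtain ⟨s, k, hs, hk, hx, hy, hz⟩ := this
    refine ⟨s, k, hs, hk, ?_⟩
    rw [conicVec, ← hx, ← hy, ← hz, smul_add, smul_add, smul_smul, smul_smul, smul_smul]
  generalize φ (φ θ) = θ₂ at *
  generalize φ θ = θ₁ at *
  have hpt : ∀ η : K, (![η, 1] : Fin 2 → K) ≠ 0 := fun η h => one_ne_zero (congrFun h 1)
  by_cases hx : x = 0
  · by_cases hy : y = 0
    · have hz : z ≠ 0 := fun hz => hxyz ⟨hx, hy, hz⟩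
      refine ⟨![θ₂, 1], (θ₂ - θ) * (θ₂ - θ₁) / z, hpt _,
        div_ne_zero (mul_ne_zero n02 n12) hz, ?_, ?_, ?_⟩ <;>
        simp [linForm, hx, hy, hz]
    · have hz : z = 0 := by
        rw [hx, zero_mul, zero_mul, mul_zero, mul_zero, add_zero, add_zero] at h
        exact ((mul_eq_zero.1 ((mul_eq_zero.1 h).resolve_left n12))).resolve_left hy
      refine ⟨![θ₁, 1], (θ₁ - θ) * (θ₁ - θ₂) / y, hpt _,
        div_ne_zero (mul_ne_zero n01 (by rw [← neg_sub]; exact neg_ne_zero.2 n12)) hy,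
        ?_, ?_, ?_⟩ <;>
        simp [linForm, hx, hy, hz]
  · by_cases hy : y = 0
    · have hz : z = 0 := by
        rw [hy, zero_mul, mul_zero, mul_zero, mul_zero, add_zero, zero_add] at h
        have n02' : θ - θ₂ ≠ 0 := by rw [← neg_sub]; exact neg_ne_zero.2 n02
        exact ((mul_eq_zero.1 ((mul_eq_zero.1 h).resolve_left n02'))).resolve_left hx
      refine ⟨![θ, 1], (θ - θ₁) * (θ - θ₂) / x, hpt _,
        div_ne_zero (mul_ne_zero (by rw [← neg_sub]; exact neg_ne_zero.2 n01)
          (by rw [← neg_sub]; exact neg_ne_zero.2 n02)) hx, ?_, ?_, ?_⟩ <;>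
        simp [linForm, hx, hy, hz]
    · have hz : z ≠ 0 := by
        rintro rfl
        rw [mul_zero, mul_zero, mul_zero, mul_zero, zero_add, zero_add] at h
        exact mul_ne_zero n01 (mul_ne_zero hx hy) h
      -- the parameter with `L₀ : L₁ : L₂ = 1 / x : 1 / y : 1 / z`
      obtain ⟨s, h0, h1⟩ := exists_linForm_eq (θ₀ := θ) (θ₁ := θ₁) (sub_ne_zero.1 n01)
        (y * z) (x * z)
      have h2 : linForm θ₂ s = x * y := by
        refine mul_left_cancel₀ n01 ?_
        have hL : (θ₂ - θ₁) * linForm θ s + (θ - θ₂) * linForm θ₁ s +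
            (θ₁ - θ) * linForm θ₂ s = 0 := by
          unfold linForm; ring
        linear_combination hL - h - (θ₂ - θ₁) * h0 - (θ - θ₂) * h1
      refine ⟨s, x * y * z, ?_, mul_ne_zero (mul_ne_zero hx hy) hz, ?_, ?_, ?_⟩
      · rintro rfl
        simp only [linForm, Pi.zero_apply, mul_zero, sub_zero] at h0
        exact mul_ne_zero hy hz h0.symm
      · rw [h1, h2]; ring
      · rw [h0, h2]; ring
      · rw [h0, h1]; ring

/-- A twisted cubic over `F` that passes over `K` through the points with the conjugate parameters
`(θᵢ : 1)`, written in terms of these points: the difference of the cubic form and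
`L₀ L₁ L₂ w₀` is divisible by `s₁`, and the quotient is found by Lagrange interpolation. -/
theorem nrcVec_cubic (hK : Module.finrank F K = 3) {θ : K} (hθ : φ θ ≠ θ)
    (w : Fin 4 → Fin n → F) (s : Fin 2 → K) :
    nrcVec (d := 3) (fun j => extVec F K n (w j)) s =
      (linForm θ s * linForm (φ θ) s * linForm (φ (φ θ)) s) • extVec F K n (w 0) +
        s 1 • conicVec F θ (((θ - φ θ) * (θ - φ (φ θ)))⁻¹ •
          nrcVec (d := 3) (fun j => extVec F K n (w j)) ![θ, 1]) s := by
  have n01 : φ θ - θ ≠ 0 := sub_ne_zero.2 hθ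
  have n02 : φ (φ θ) - θ ≠ 0 := sub_ne_zero.2 (frob_frob_ne hK hθ)
  have n12 : φ (φ θ) - φ θ ≠ 0 := sub_ne_zero.2 fun h => hθ (frob_injective h)
  have hfrob : ∀ η : K, frobVec F K n (nrcVec (d := 3) (fun j => extVec F K n (w j)) ![η, 1]) =
      nrcVec (d := 3) (fun j => extVec F K n (w j)) ![φ η, 1] := by
    intro η
    simp only [nrcVec, map_sum, frobVec_smul, frobVec_extVec, map_mul, map_pow,
      Matrix.cons_val_zero, Matrix.cons_val_one, map_one]
  simp only [conicVec, frobVec_smul, hfrob, map_inv₀, map_mul, map_sub, frob_frob_frob hK]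
  generalize φ (φ θ) = θ₂ at *
  generalize φ θ = θ₁ at *
  ext m
  simp only [nrcVec_three, linForm, Matrix.cons_val_zero, Matrix.cons_val_one,
    Pi.add_apply, Pi.smul_apply, smul_eq_mul, one_pow, mul_one, one_mul]
  generalize extVec F K n (w 0) m = x₀
  generalize extVec F K n (w 1) m = x₁
  generalize extVec F K n (w 2) m = x₂
  generalize extVec F K n (w 3) m = x₃
  have n10 : θ - θ₁ ≠ 0 := by rw [← neg_sub]; exact neg_ne_zero.2 n01
  have n20 : θ - θ₂ ≠ 0 := by rw [← neg_sub]; exact neg_ne_zero.2 n02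
  have n21 : θ₁ - θ₂ ≠ 0 := by rw [← neg_sub]; exact neg_ne_zero.2 n12
  field_simp
  ring

end Conjugates

/-! ### Ruled surfaces and their rational points -/

section Ruled

theorem mem_ruledSurface_iff {E V : Type*} [Field E] [AddCommGroup V] [Module E V] {d e : ℕ}
    {u : Fin (d + 1) → V} {w : Fin (e + 1) → V} (hu : LinearIndependent E u) {C D : Set (ℙ E V)}
    (hC : C = nrc E u) {κ : C → D}
    (hκ : ∀ (X : C) (s : Fin 2 → E), s ≠ 0 → X.1.submodule = E ∙ nrcVec u s →
      (κ X).1.submodule = E ∙ nrcVec w s) (R : ℙ E V) :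
    R ∈ ruledSurface κ ↔
      ∃ s : Fin 2 → E, s ≠ 0 ∧ R.submodule ≤ (E ∙ nrcVec u s) ⊔ E ∙ nrcVec w s := by
  constructor
  · rintro ⟨X, hX⟩
    obtain ⟨s, hs, hXs⟩ : X.1 ∈ nrc E u := hC ▸ X.2
    refine ⟨s, hs, ?_⟩
    rwa [← hXs, ← hκ X s hs hXs]
  · rintro ⟨s, hs, h⟩
    obtain ⟨X, hX, hXs⟩ := exists_mem_nrc hu hs
    refine ⟨⟨X, hC ▸ hX⟩, ?_⟩
    rwa [hκ _ s hs hXs, hXs]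

variable {F K : Type*} [Field F] [Field K] [Algebra F K] {n d e : ℕ}

theorem extPt_mk_submodule {v : Fin n → F} (hv : v ≠ 0) :
    (extPt F K n (Projectivization.mk F v hv)).submodule = K ∙ extVec F K n v :=
  extPt_submodule _ (Projectivization.submodule_mk v hv)

theorem mem_span_of_extVec_mem {x y : Fin n → F} (h : extVec F K n x ∈ K ∙ extVec F K n y) :
    x ∈ F ∙ y := by
  rw [← extVec_mem_extSub_iff (K := K)]
  refine (?_ : (K ∙ extVec F K n y) ≤ extSub K (F ∙ y)) h
  rw [Submodule.span_singleton_le_iff_mem]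
  exact extVec_mem_extSub (Submodule.mem_span_singleton_self y)

theorem span_nrcVec_extVec (w : Fin (d + 1) → Fin n → F) {c : K} (hc : c ≠ 0) (t : Fin 2 → F) :
    (K ∙ nrcVec (fun j => extVec F K n (w j)) (c • extVec F K 2 t)) =
      K ∙ extVec F K n (nrcVec w t) := by
  rw [nrcVec_smul, nrcVec_extVec]
  exact Submodule.span_singleton_smul_eq (IsUnit.mk0 _ (pow_ne_zero _ hc)) _

theorem exists_rational_param_of_mem (hd : 1 ≤ d) {u : Fin (d + 1) → Fin n → F}
    (hu : LinearIndependent F u) {v : Fin n → F} (hv : v ≠ 0) {s : Fin 2 → K} (hs : s ≠ 0)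
    (h : extVec F K n v ∈ K ∙ nrcVec (fun j => extVec F K n (u j)) s) :
    ∃ (t : Fin 2 → F) (c : K), t ≠ 0 ∧ c ≠ 0 ∧ s = c • extVec F K 2 t :=
  have ⟨_, hk⟩ := Submodule.mem_span_singleton.1 h
  exists_rational_param hd hu hv hs hk.symm

theorem extPt_mem_nrc_iff (hd : 1 ≤ d) {u : Fin (d + 1) → Fin n → F}
    (hu : LinearIndependent F u) (X : ℙ F (Fin n → F)) :
    extPt F K n X ∈ nrc K (fun j => extVec F K n (u j)) ↔ X ∈ nrc F u := by
  constructor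
  · rintro ⟨s, hs, hX⟩
    induction X with
    | h x hx =>
      rw [extPt_mk_submodule] at hX
      obtain ⟨t, c, ht, hc, rfl⟩ := exists_rational_param_of_mem hd hu hx hs
        (hX ▸ Submodule.mem_span_singleton_self _)
      rw [span_nrcVec_extVec u hc] at hX
      refine ⟨t, ht, ?_⟩
      rw [Projectivization.submodule_mk]
      refine le_antisymm ?_ ?_ <;> rw [Submodule.span_singleton_le_iff_mem]
      · exact mem_span_of_extVec_mem (K := K) (hX ▸ Submodule.mem_span_singleton_self _)
      · exact mem_span_of_extVec_mem (K := K) (hX.symm ▸ Submodule.mem_span_singleton_self _)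
  · rintro ⟨t, ht, hX⟩
    refine ⟨extVec F K 2 t, extVec_ne_zero ht, ?_⟩
    rw [extPt_submodule X hX, nrcVec_extVec]

theorem extPt_mem_conic_iff {f : MvPolynomial (Fin n) F} (hf : f.IsHomogeneous 2)
    (U : Submodule F (Fin n → F)) (X : ℙ F (Fin n → F)) :
    extPt F K n X ∈ conic K (extSub K U) f ↔ X ∈ conic F U f := by
  induction X with
  | h x hx =>
    rw [extPt, Projectivization.map_mk, mem_conic_mk hf, mem_conic_mk hf,
      extVec_mem_extSub_iff, aeval_extVec, map_eq_zero_iff _ (algebraMap F K).injective]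

theorem disjoint_extSub {U W : Submodule F (Fin n → F)} (h : Disjoint U W) :
    Disjoint (extSub K U) (extSub K W) := by
  have hsup : extSub K U ⊔ extSub K W = extSub K (U ⊔ W) := by
    refine le_antisymm (sup_le (extSub_mono le_sup_left) (extSub_mono le_sup_right))
      (Submodule.span_le.2 ?_)
    rintro _ ⟨x, hx, rfl⟩
    obtain ⟨y, hy, z, hz, rfl⟩ := Submodule.mem_sup.1 hx
    rw [map_add]
    exact Submodule.add_mem_sup (extVec_mem_extSub hy) (extVec_mem_extSub hz)
  have h1 := Submodule.finrank_sup_add_finrank_inf_eq (extSub K U) (extSub K W)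
  have h2 := Submodule.finrank_sup_add_finrank_inf_eq U W
  rw [hsup, finrank_extSub, finrank_extSub, finrank_extSub] at h1
  rw [h.eq_bot, finrank_bot] at h2
  rw [disjoint_iff, ← Submodule.finrank_eq_zero (R := K)]
  omega

theorem nrcVec_extVec_mem_extSub (w : Fin (d + 1) → Fin n → F) (s : Fin 2 → K) :
    nrcVec (fun j => extVec F K n (w j)) s ∈ extSub K (Submodule.span F (Set.range w)) :=
  Submodule.sum_mem _ fun i _ => Submodule.smul_mem _ _
    (extVec_mem_extSub (Submodule.subset_span ⟨i, rfl⟩))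

/-- A rational point on a line that joins points with the same parameter on two extended curves in
skew subspaces lies on such a line with a rational parameter: its two components are rational, and
one of them is a point of a curve. -/
theorem exists_rational_ruling (hd : 1 ≤ d) (he : 1 ≤ e) {u : Fin (d + 1) → Fin n → F}
    {w : Fin (e + 1) → Fin n → F} (hu : LinearIndependent F u) (hw : LinearIndependent F w)
    (hdisj : Disjoint (Submodule.span F (Set.range u)) (Submodule.span F (Set.range w)))
    {v : Fin n → F} (hv : v ≠ 0) {s : Fin 2 → K} (hs : s ≠ 0)
    (h : extVec F K n v ∈ (K ∙ nrcVec (fun j => extVec F K n (u j)) s) ⊔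
      K ∙ nrcVec (fun j => extVec F K n (w j)) s) :
    ∃ t : Fin 2 → F, t ≠ 0 ∧ v ∈ (F ∙ nrcVec u t) ⊔ F ∙ nrcVec w t := by
  obtain ⟨x, hx, y, hy, hxy⟩ := Submodule.mem_sup.1 h
  have hx' : x ∈ extSub K (Submodule.span F (Set.range u)) :=
    (Submodule.span_singleton_le_iff_mem _ _).2 (nrcVec_extVec_mem_extSub u s) hx
  have hy' : y ∈ extSub K (Submodule.span F (Set.range w)) :=
    (Submodule.span_singleton_le_iff_mem _ _).2 (nrcVec_extVec_mem_extSub w s) hy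
  have hvmem : v ∈ Submodule.span F (Set.range u) ⊔ Submodule.span F (Set.range w) := by
    rw [← extVec_mem_extSub_iff (K := K), ← hxy]
    exact add_mem (extSub_mono le_sup_left hx') (extSub_mono le_sup_right hy')
  obtain ⟨a, ha, b, hb, rfl⟩ := Submodule.mem_sup.1 hvmem
  rw [map_add] at hxy
  have hxa : x - extVec F K n a = 0 := by
    refine Submodule.disjoint_def.1 (disjoint_extSub (K := K) hdisj) _
      (sub_mem hx' (extVec_mem_extSub ha)) ?_
    rw [show x - extVec F K n a = extVec F K n b - y by
      rw [sub_eq_sub_iff_add_eq_add, hxy, add_comm]]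
    exact sub_mem (extVec_mem_extSub hb) hy'
  obtain rfl := sub_eq_zero.1 hxa
  obtain rfl : y = extVec F K n b := add_left_cancel hxy
  have key : ∃ (t : Fin 2 → F) (c : K), t ≠ 0 ∧ c ≠ 0 ∧ s = c • extVec F K 2 t := by
    by_cases ha0 : a = 0
    · have hb0 : b ≠ 0 := fun hb0 => hv (by rw [ha0, hb0, add_zero])
      exact exists_rational_param_of_mem he hw hb0 hs hy
    · exact exists_rational_param_of_mem hd hu ha0 hs hx
  obtain ⟨t, c, ht, hc, rfl⟩ := key
  rw [span_nrcVec_extVec _ hc] at hx hy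
  exact ⟨t, ht, Submodule.add_mem_sup (mem_span_of_extVec_mem hx) (mem_span_of_extVec_mem hy)⟩

theorem preimage_ruledSurface (hd : 1 ≤ d) (he : 1 ≤ e) {u : Fin (d + 1) → Fin n → F}
    {w : Fin (e + 1) → Fin n → F} (hu : LinearIndependent F u) (hw : LinearIndependent F w)
    (hdisj : Disjoint (Submodule.span F (Set.range u)) (Submodule.span F (Set.range w)))
    {C D : Set (ℙ K (Fin n → K))} {C₀ D₀ : Set (ℙ F (Fin n → F))}
    (hC : C = nrc K fun j => extVec F K n (u j)) (hC₀ : C₀ = nrc F u) {κ : C → D} {κ₀ : C₀ → D₀}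
    (hκ : ∀ (X : C) (s : Fin 2 → K), s ≠ 0 →
      X.1.submodule = K ∙ nrcVec (fun j => extVec F K n (u j)) s →
      (κ X).1.submodule = K ∙ nrcVec (fun j => extVec F K n (w j)) s)
    (hκ₀ : ∀ (X : C₀) (s : Fin 2 → F), s ≠ 0 → X.1.submodule = F ∙ nrcVec u s →
      (κ₀ X).1.submodule = F ∙ nrcVec w s) :
    extPt F K n ⁻¹' ruledSurface κ = ruledSurface κ₀ := by
  ext R
  refine (mem_ruledSurface_iff (u := fun j => extVec F K n (u j))
    (w := fun j => extVec F K n (w j)) (linearIndependent_extVec hu) hC (κ := κ) hκ _).trans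
    (Iff.trans ?_ (mem_ruledSurface_iff hu hC₀ hκ₀ R).symm)
  induction R with
  | h v hv =>
    rw [extPt_mk_submodule, Projectivization.submodule_mk]
    constructor
    · rintro ⟨s, hs, h⟩
      rw [Submodule.span_singleton_le_iff_mem] at h
      simp only [Submodule.span_singleton_le_iff_mem]
      exact exists_rational_ruling hd he hu hw hdisj hv hs h
    · rintro ⟨t, ht, h⟩
      rw [Submodule.span_singleton_le_iff_mem] at h
      obtain ⟨x, hx, y, hy, rfl⟩ := Submodule.mem_sup.1 h
      obtain ⟨a, rfl⟩ := Submodule.mem_span_singleton.1 hx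
      obtain ⟨b, rfl⟩ := Submodule.mem_span_singleton.1 hy
      refine ⟨extVec F K 2 t, extVec_ne_zero ht, ?_⟩
      rw [Submodule.span_singleton_le_iff_mem, map_add, extVec_smul, extVec_smul,
        nrcVec_extVec, nrcVec_extVec]
      exact Submodule.add_mem_sup (Submodule.smul_mem _ _ (Submodule.mem_span_singleton_self _))
        (Submodule.smul_mem _ _ (Submodule.mem_span_singleton_self _))

end Ruled

/-! ### The subplane of order `q` -/

section Subplane

open Matrix

variable {F K : Type*} [Field F] [Field K] [Algebra F K]

/-- The embedding `(x, y, z) ↦ (x, y, z - θ y)` of `PG(2, q)` in `PG(2, q³)`, on coordinate vectors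
of points: the standard subplane, moved by a change of coordinates over `K`. -/
def subplanePoint (F : Type*) [Field F] [Algebra F K] (θ : K) :
    (Fin 3 → F) →ₛₗ[algebraMap F K] (Fin 3 → K) where
  toFun v := ![algebraMap F K (v 0), algebraMap F K (v 1),
    algebraMap F K (v 2) - θ * algebraMap F K (v 1)]
  map_add' v w := by
    ext i
    fin_cases i <;> simp
    ring
  map_smul' c v := by
    ext i
    fin_cases i <;> simp
    ring

/-- The embedding `(a, b, c) ↦ (a, b + θ c, c)` of `PG(2, q)` in `PG(2, q³)`, on coordinate vectors of
lines. It is contragredient to `subplanePoint`, so that dot products and incidence agree. -/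
def subplaneLine (F : Type*) [Field F] [Algebra F K] (θ : K) :
    (Fin 3 → F) →ₛₗ[algebraMap F K] (Fin 3 → K) where
  toFun v := ![algebraMap F K (v 0), algebraMap F K (v 1) + θ * algebraMap F K (v 2),
    algebraMap F K (v 2)]
  map_add' v w := by
    ext i
    fin_cases i <;> simp
    ring
  map_smul' c v := by
    ext i
    fin_cases i <;> simp
    ring

theorem subplanePoint_injective (θ : K) : Function.Injective (subplanePoint F θ) := by
  intro v w h
  have h0 : algebraMap F K (v 0) = algebraMap F K (w 0) := congrFun h 0
  have h1 : algebraMap F K (v 1) = algebraMap F K (w 1) := congrFun h 1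
  have h2 : algebraMap F K (v 2) - θ * algebraMap F K (v 1) =
      algebraMap F K (w 2) - θ * algebraMap F K (w 1) := congrFun h 2
  rw [h1, sub_left_inj] at h2
  ext i
  fin_cases i
  · exact (algebraMap F K).injective h0
  · exact (algebraMap F K).injective h1
  · exact (algebraMap F K).injective h2

theorem subplaneLine_injective (θ : K) : Function.Injective (subplaneLine F θ) := by
  intro v w h
  have h0 : algebraMap F K (v 0) = algebraMap F K (w 0) := congrFun h 0
  have h1 : algebraMap F K (v 1) + θ * algebraMap F K (v 2) =
      algebraMap F K (w 1) + θ * algebraMap F K (w 2) := congrFun h 1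
  have h2 : algebraMap F K (v 2) = algebraMap F K (w 2) := congrFun h 2
  rw [h2, add_left_inj] at h1
  ext i
  fin_cases i
  · exact (algebraMap F K).injective h0
  · exact (algebraMap F K).injective h1
  · exact (algebraMap F K).injective h2

theorem subplanePoint_dotProduct (θ : K) (v c : Fin 3 → F) :
    subplanePoint F θ v ⬝ᵥ subplaneLine F θ c = algebraMap F K (v ⬝ᵥ c) := by
  simp only [dotProduct, Fin.sum_univ_three, map_add, map_mul, subplanePoint, subplaneLine,
    LinearMap.coe_mk, AddHom.coe_mk, cons_val_zero, cons_val_one, cons_val]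
  ring

theorem map_subplane_mem_iff (θ : K) (p l : ℙ F (Fin 3 → F)) :
    Projectivization.map (subplanePoint F θ) (subplanePoint_injective θ) p ∈
      Projectivization.map (subplaneLine F θ) (subplaneLine_injective θ) l ↔ p ∈ l := by
  induction p with
  | h v hv =>
    induction l with
    | h c hc =>
      rw [Projectivization.map_mk, Projectivization.map_mk, Configuration.ofField.mem_iff,
        Configuration.ofField.mem_iff, Projectivization.orthogonal_mk,
        Projectivization.orthogonal_mk, subplanePoint_dotProduct,
        map_eq_zero_iff _ (algebraMap F K).injective]

theorem mapSubplanePoint_injective (θ : K) : Function.Injective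
    (Projectivization.map (subplanePoint F θ) (subplanePoint_injective θ)) := fun p q h =>
  point_eq_of_forall_mem fun l hl => by
    rw [← map_subplane_mem_iff θ] at hl ⊢
    rwa [← h]

theorem mapSubplaneLine_injective (θ : K) : Function.Injective
    (Projectivization.map (subplaneLine F θ) (subplaneLine_injective θ)) := fun l m h =>
  line_eq_of_forall_mem fun p hp => by
    rw [← map_subplane_mem_iff θ] at hp ⊢
    rwa [← h]

theorem mem_bbSet_iff {n : ℕ} {H : Submodule F (Fin n → F)} {S : Set (Submodule F (Fin n → F))}
    (B : Set (ℙ F (Fin n → F))) (p : BBPoint H S) :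
    p ∈ bbSet H S B ↔ ∃ X ∈ B, X.submodule ≤ p.sub := by
  rcases p with ⟨Y, hY⟩ | ⟨σ, hσ⟩
  · refine ⟨fun h => ⟨Y, h, le_rfl⟩, ?_⟩
    rintro ⟨X, hX, hXY⟩
    obtain rfl : X = Y := Projectivization.submodule_injective
      (Submodule.eq_of_le_of_finrank_eq hXY (by
        rw [Projectivization.finrank_submodule]
        exact Y.finrank_submodule.symm))
    exact hX
  · exact Iff.rfl

end Subplane

/-! ### The subplane of a ruled surface -/

section RuledSurfaceSubplane

variable {F K : Type*} [Field F] [Fintype F] [Field K] [Algebra F K]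

local notation "φ" => FiniteField.frobeniusAlgHom F K

theorem linForm_ne_zero {η : K} (hη : φ η ≠ η) {t : Fin 2 → F} (ht : t ≠ 0) :
    linForm η (extVec F K 2 t) ≠ 0 := by
  intro h
  have h' : algebraMap F K (t 0) - η * algebraMap F K (t 1) = 0 := h
  by_cases h1 : t 1 = 0
  · rw [h1, map_zero, mul_zero, sub_zero, map_eq_zero_iff _ (algebraMap F K).injective] at h'
    refine ht ?_
    ext i
    fin_cases i <;> assumption
  · have h1' : algebraMap F K (t 1) ≠ 0 := by
      rwa [Ne, map_eq_zero_iff _ (algebraMap F K).injective]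
    refine hη ?_
    have : η = algebraMap F K (t 0 / t 1) := by
      rw [map_div₀, eq_div_iff h1']
      linear_combination -h'
    rw [this, frob_algebraMap]

theorem frobVec_nrcVec {n d : ℕ} (w : Fin (d + 1) → Fin n → F) (η : K) :
    frobVec F K n (nrcVec (fun j => extVec F K n (w j)) ![η, 1]) =
      nrcVec (fun j => extVec F K n (w j)) ![φ η, 1] := by
  simp only [nrcVec, map_sum, frobVec_smul, frobVec_extVec, map_mul, map_pow,
    Matrix.cons_val_zero, Matrix.cons_val_one, map_one]

/-- The rational points of the twisted cubic in the form that separates the vector `w 0` outside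
the hyperplane from the part in the hyperplane. -/
theorem nrcVec_rational_cubic (hK : Module.finrank F K = 3) {n : ℕ} {θ : K} {ρ : Fin n → K}
    {w : Fin 4 → Fin n → F}
    (hw : ∀ s, nrcVec (d := 3) (fun j => extVec F K n (w j)) s =
      (linForm θ s * linForm (φ θ) s * linForm (φ (φ θ)) s) • extVec F K n (w 0) +
        s 1 • conicVec F θ ρ s) (t : Fin 2 → F) :
    ∃ c : F, algebraMap F K c = linForm θ (extVec F K 2 t) *
        linForm (φ θ) (extVec F K 2 t) * linForm (φ (φ θ)) (extVec F K 2 t) ∧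
      nrcVec (d := 3) w t = c • w 0 + t 1 • traceMap ρ
        (linForm (φ θ) (extVec F K 2 t) * linForm (φ (φ θ)) (extVec F K 2 t)) := by
  have hφ : ∀ η : K, φ (linForm η (extVec F K 2 t)) = linForm (φ η) (extVec F K 2 t) := by
    intro η
    change φ (algebraMap F K (t 0) - η * algebraMap F K (t 1)) =
      algebraMap F K (t 0) - φ η * algebraMap F K (t 1)
    rw [map_sub, map_mul, frob_algebraMap, frob_algebraMap]
  obtain ⟨c, hc⟩ := exists_algebraMap_eq_of_frob_eq hK (x := linForm θ (extVec F K 2 t) *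
    linForm (φ θ) (extVec F K 2 t) * linForm (φ (φ θ)) (extVec F K 2 t)) (by
      rw [map_mul, map_mul, hφ, hφ, hφ, frob_frob_frob hK]
      ring)
  refine ⟨c, hc, extVec_injective F K n ?_⟩
  rw [← nrcVec_extVec, hw, ← hc, ← nrcVec_conicFrame hK, nrcVec_extVec,
    nrcVec_conicFrame_rational, map_add, extVec_smul, extVec_smul]
  rfl

/-- The correspondence of a ruled surface with a subplane: in the coordinates of the Bruck–Bose
plane with respect to `p, ρ, w 0`, the point `a u(t) + b w(t)` of the ruled surface is the point of
the subplane with coordinates `a, b t₁, b t₀`. -/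
theorem isSubplane_and_isTangent (hK : Module.finrank F K = 3) {H : Submodule F (Fin 7 → F)}
    {S : Set (Submodule F (Fin 7 → F))} {g : Submodule K (Fin 7 → K)}
    (hS : IsRegularSpread H S g) {θ : K} (hθ : φ θ ≠ θ) {p ρ : Fin 7 → K} (hp : p ∈ g)
    (hρ : ρ ∈ g) (hpρ : LinearIndependent K ![p, ρ]) {w : Fin 4 → Fin 7 → F} (hw0 : w 0 ∉ H)
    (hw : ∀ s, nrcVec (d := 3) (fun j => extVec F K 7 (w j)) s =
      (linForm θ s * linForm (φ θ) s * linForm (φ (φ θ)) s) • extVec F K 7 (w 0) +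
        s 1 • conicVec F θ ρ s) {B : Set (ℙ F (Fin 7 → F))}
    (hB : ∀ R, R ∈ B ↔ ∃ t : Fin 2 → F, t ≠ 0 ∧
      R.submodule ≤ (F ∙ nrcVec (d := 2) (conicFrame F θ p) t) ⊔ F ∙ nrcVec (d := 3) w t) :
    Nonempty (IncidenceIso (BBPoint H S) (BBLine H S) (ℙ K (Fin 3 → K)) (ℙ K (Fin 3 → K))) ∧
    ∀ Φ : IncidenceIso (BBPoint H S) (BBLine H S) (ℙ K (Fin 3 → K)) (ℙ K (Fin 3 → K)),
      IsSubplaneOfOrder (ℙ K (Fin 3 → K)) (Φ.onPoints '' bbSet H S B) (Fintype.card F) ∧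
      IsTangent (Φ.onLines .infinity) (Φ.onPoints '' bbSet H S B) := by
  classical
  obtain ⟨D, hD, hDv⟩ := hS.exists_planeCoordinates hK hp hρ hpρ hw0
  obtain ⟨eP, eL, hPsub, hLsub, hmem⟩ := hD.exists_equivs hK hS.isTwoSpread.finrank_eq
  have hφθ : φ (φ θ) ≠ φ θ := fun h => hθ (frob_injective h)
  have hφφθ : φ (φ (φ θ)) ≠ φ (φ θ) := fun h => hφθ (frob_injective h)
  let lam : (Fin 2 → F) → K := fun t =>
    linForm (φ θ) (extVec F K 2 t) * linForm (φ (φ θ)) (extVec F K 2 t)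
  have hlam : ∀ t, t ≠ 0 → lam t ≠ 0 := fun t ht =>
    mul_ne_zero (linForm_ne_zero hφθ ht) (linForm_ne_zero hφφθ ht)
  have hDcoord : ∀ (t : Fin 2 → F) (a b : F),
      D (a • nrcVec (d := 2) (conicFrame F θ p) t + b • nrcVec (d := 3) w t) =
        lam t • subplanePoint F θ ![a, b * t 1, b * t 0] := by
    intro t a b
    obtain ⟨c, hc, hwt⟩ := nrcVec_rational_cubic hK hw t
    rw [nrcVec_conicFrame_rational, hwt]
    have h := hDv (algebraMap F K a * lam t) (algebraMap F K (b * t 1) * lam t) (b * c)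
    rw [mul_smul _ (lam t) p, mul_smul _ (lam t) ρ, algebraMap_smul, algebraMap_smul,
      map_add (traceVec F K 7), map_smul (traceVec F K 7), map_smul (traceVec F K 7)] at h
    rw [show a • traceMap p (lam t) + b • (c • w 0 + t 1 • traceMap ρ (lam t)) =
      a • traceVec F K 7 (lam t • p) + (b * t 1) • traceVec F K 7 (lam t • ρ) + (b * c) • w 0 by
        rw [traceMap_apply, traceMap_apply, smul_add, smul_smul, smul_smul]
        abel]
    rw [h]
    ext i
    fin_cases i
    · exact mul_comm _ _
    · exact mul_comm _ _
    · change algebraMap F K (b * c) =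
        lam t * (algebraMap F K (b * t 0) - θ * algebraMap F K (b * t 1))
      rw [map_mul, map_mul, map_mul, hc]
      change _ * ((algebraMap F K (t 0) - θ * algebraMap F K (t 1)) * _ * _) = _ * _ * _
      ring
  let j := Projectivization.map (subplanePoint F θ) (subplanePoint_injective θ)
  let jL := Projectivization.map (subplaneLine F θ) (subplaneLine_injective θ)
  have hj : ∀ (v : Fin 3 → F) (hv : v ≠ 0),
      (j (Projectivization.mk F v hv)).submodule = K ∙ subplanePoint F θ v := fun v hv =>
    congrArg Projectivization.submodule (Projectivization.map_mk _ _ v hv)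
  have hset : bbSet H S B = Set.range fun q => eP (j q) := by
    ext X
    obtain ⟨q, rfl⟩ := eP.surjective X
    rw [mem_bbSet_iff, hPsub]
    constructor
    · rintro ⟨R, hR, hRq⟩
      obtain ⟨t, ht, hRt⟩ := (hB R).1 hR
      induction R with
      | h x hx =>
        rw [Projectivization.submodule_mk, Submodule.span_singleton_le_iff_mem] at hRt hRq
        obtain ⟨y, hy, z, hz, rfl⟩ := Submodule.mem_sup.1 hRt
        obtain ⟨a, rfl⟩ := Submodule.mem_span_singleton.1 hy
        obtain ⟨b, rfl⟩ := Submodule.mem_span_singleton.1 hz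
        have hv : (![a, b * t 1, b * t 0] : Fin 3 → F) ≠ 0 := by
          intro hv
          refine hx (hD.injective ?_)
          rw [hDcoord, hv, map_zero, map_zero, smul_zero]
        refine ⟨Projectivization.mk F _ hv, congrArg eP (Projectivization.submodule_injective ?_)⟩
        refine Submodule.eq_of_le_of_finrank_eq ?_ (by
          rw [Projectivization.finrank_submodule, Projectivization.finrank_submodule])
        rw [hj, Submodule.span_singleton_le_iff_mem]
        have hmemq : D (a • nrcVec (d := 2) (conicFrame F θ p) t + b • nrcVec (d := 3) w t) ∈
            q.submodule := hRq
        rw [hDcoord] at hmemq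
        exact (Submodule.smul_mem_iff _ (hlam t ht)).1 hmemq
    · rintro ⟨r, hr⟩
      obtain rfl := eP.injective hr
      induction r with
      | h v hv =>
        have hex : ∃ (t : Fin 2 → F) (a b : F), t ≠ 0 ∧ ![a, b * t 1, b * t 0] = v := by
          by_cases h : v 1 = 0 ∧ v 2 = 0
          · refine ⟨![1, 0], v 0, 0, fun h => one_ne_zero (congrFun h 0), ?_⟩
            ext i
            fin_cases i <;> simp [h.1, h.2]
          · refine ⟨![v 2, v 1], v 0, 1, fun h' => h ⟨congrFun h' 1, congrFun h' 0⟩, ?_⟩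
            ext i
            fin_cases i <;> simp
        obtain ⟨t, a, b, ht, rfl⟩ := hex
        have hx : a • nrcVec (d := 2) (conicFrame F θ p) t + b • nrcVec (d := 3) w t ≠ 0 := by
          intro hx
          have h0 := hDcoord t a b
          rw [hx, map_zero, eq_comm, smul_eq_zero] at h0
          exact hv (subplanePoint_injective θ ((h0.resolve_left (hlam t ht)).trans
            (map_zero _).symm))
        refine ⟨Projectivization.mk F _ hx, (hB _).2 ⟨t, ht, ?_⟩, ?_⟩
        · rw [Projectivization.submodule_mk, Submodule.span_singleton_le_iff_mem]
          exact Submodule.add_mem_sup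
            (Submodule.smul_mem _ _ (Submodule.mem_span_singleton_self _))
            (Submodule.smul_mem _ _ (Submodule.mem_span_singleton_self _))
        · rw [Projectivization.submodule_mk, Submodule.span_singleton_le_iff_mem,
            hj]
          change D _ ∈ K ∙ _
          rw [hDcoord]
          exact Submodule.smul_mem _ _ (Submodule.mem_span_singleton_self _)
  have he2 : (![0, 0, 1] : Fin 3 → K) ≠ 0 := fun h => one_ne_zero (congrFun h 2)
  have hinf : eL (Projectivization.mk K ![0, 0, 1] he2) = .infinity :=
    BBLine.sub_injective ((hLsub _).trans (hD.pullback_lineSub_of_eq_zero he2 rfl rfl))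
  have hjinf : ∀ (v : Fin 3 → F) (hv : v ≠ 0),
      eP (j (Projectivization.mk F v hv)) ∈ (BBLine.infinity : BBLine H S) ↔
        v 1 = 0 ∧ v 2 = 0 := by
    intro v hv
    rw [← hinf, hmem, show j (Projectivization.mk F v hv) = _ from
      Projectivization.map_mk _ _ v hv, Configuration.ofField.mem_iff,
      Projectivization.orthogonal_mk, dotProduct, Fin.sum_univ_three]
    simp only [Matrix.cons_val_zero, Matrix.cons_val_one, Matrix.cons_val, mul_zero, zero_add,
      mul_one]
    change algebraMap F K (v 2) - θ * algebraMap F K (v 1) = 0 ↔ _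
    refine ⟨fun h => ?_, fun h => by rw [h.1, h.2, map_zero, mul_zero, sub_zero]⟩
    by_contra hne
    exact linForm_ne_zero hθ (t := ![v 2, v 1])
      (fun h' => hne ⟨congrFun h' 1, congrFun h' 0⟩) h
  refine ⟨⟨⟨eP.symm, eL.symm, fun X l => ?_⟩⟩, fun Φ => ?_⟩
  · rw [← hmem, Equiv.apply_symm_apply, Equiv.apply_symm_apply]
  have himage : Φ.onPoints '' bbSet H S B = Set.range fun q => Φ.onPoints (eP (j q)) := by
    rw [hset, ← Set.range_comp]
    rfl
  rw [himage]
  constructor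
  · rw [← order_projectivization F]
    refine isSubplaneOfOrder_range (f := fun q => Φ.onPoints (eP (j q)))
      (g := fun l => Φ.onLines (eL (jL l))) (fun q r h => ?_) (fun l m h => ?_) fun q l => ?_
    · exact mapSubplanePoint_injective θ (eP.injective (Φ.onPoints.injective h))
    · exact mapSubplaneLine_injective θ (eL.injective (Φ.onLines.injective h))
    · rw [Φ.mem_iff, hmem]
      exact map_subplane_mem_iff θ q l
  · have he0 : (![1, 0, 0] : Fin 3 → F) ≠ 0 := fun h => one_ne_zero (congrFun h 0)
    refine ⟨_, ⟨⟨Projectivization.mk F ![1, 0, 0] he0, rfl⟩, ?_⟩, ?_⟩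
    · exact (Φ.mem_iff _ _).2 ((hjinf _ he0).2 ⟨rfl, rfl⟩)
    · rintro _ ⟨⟨q, rfl⟩, hq⟩
      rw [Φ.mem_iff] at hq
      induction q with
      | h v hv =>
        obtain ⟨h1, h2⟩ := (hjinf v hv).1 hq
        have : Projectivization.mk F v hv = Projectivization.mk F ![1, 0, 0] he0 := by
          rw [Projectivization.mk_eq_mk_iff']
          refine ⟨v 0, ?_⟩
          ext i
          fin_cases i <;> simp [h1, h2]
        rw [this]

end RuledSurfaceSubplane

/-! ### Parameters for the conic and the twisted cubic -/

section CurveParameters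

variable {F K : Type*} [Field F] [Fintype F] [Field K] [Algebra F K]

local notation "φ" => FiniteField.frobeniusAlgHom F K

theorem frobPt_submodule_nrcVec {n d : ℕ} (w : Fin (d + 1) → Fin n → F) {X : ℙ K (Fin n → K)}
    {η : K} (h : X.submodule = K ∙ nrcVec (fun j => extVec F K n (w j)) ![η, 1]) :
    (frobPt F K n X).submodule = K ∙ nrcVec (fun j => extVec F K n (w j)) ![φ η, 1] := by
  rw [frobPt_submodule X h, frobVec_nrcVec]

/-- The extended conic is parametrized by its frame. -/
theorem conic_eq_nrc (hK : Module.finrank F K = 3) {n : ℕ} {θ : K} (hθ : φ θ ≠ θ)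
    {f : MvPolynomial (Fin n) F} (hf : f.IsHomogeneous 2) {p : Fin n → K}
    {U : Submodule K (Fin n → K)} (hU : U = conjSpan F p) {c : K} (hc : c ≠ 0)
    (hform : ∀ x y z : K, MvPolynomial.aeval
      (x • p + y • frobVec F K n p + z • frobVec F K n (frobVec F K n p)) f =
      c * ((φ (φ θ) - φ θ) * (y * z) + (θ - φ (φ θ)) * (x * z) + (φ θ - θ) * (x * y))) :
    conic K U f = nrc K (d := 2) fun j => extVec F K n (conicFrame F θ p j) := by
  subst hU
  ext X
  induction X with
  | h v hv =>
    rw [mem_conic_mk hf, mem_conjSpan]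
    constructor
    · rintro ⟨⟨x, y, z, rfl⟩, h0⟩
      rw [hform] at h0
      obtain ⟨s, k, hs, hk, hsk⟩ := exists_conicVec_eq hK hθ (p := p)
        (fun h => hv (by rw [h.1, h.2.1, h.2.2, zero_smul, zero_smul, zero_smul]; simp))
        ((mul_eq_zero.1 h0).resolve_left hc)
      refine ⟨s, hs, ?_⟩
      rw [nrcVec_conicFrame hK, ← hsk, Projectivization.submodule_mk]
      exact (Submodule.span_singleton_smul_eq (IsUnit.mk0 _ hk) _).symm
    · rintro ⟨s, hs, h⟩
      rw [nrcVec_conicFrame hK, Projectivization.submodule_mk] at h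
      obtain ⟨k, rfl⟩ := exists_eq_smul_of_span_eq h
      have hcoord : k • conicVec F θ p s =
          (k * (linForm (φ θ) s * linForm (φ (φ θ)) s)) • p +
          (k * (linForm θ s * linForm (φ (φ θ)) s)) • frobVec F K n p +
          (k * (linForm θ s * linForm (φ θ) s)) • frobVec F K n (frobVec F K n p) := by
        rw [conicVec, smul_add, smul_add, smul_smul, smul_smul, smul_smul]
      refine ⟨⟨_, _, _, hcoord.symm⟩, ?_⟩
      rw [hcoord, hform]
      unfold linForm
      ring

/-- A twisted cubic that spans a `3`-space not contained in the hyperplane meets it only in the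
three given conjugate points, so its rational point `w 0` lies outside the hyperplane. -/
theorem frame_zero_notMem (hK : Module.finrank F K = 3) {n : ℕ} {θ : K} (hθ : φ θ ≠ θ)
    {H : Submodule F (Fin n → F)} {w : Fin 4 → Fin n → F}
    (hw : ∀ η ∈ ({θ, φ θ, φ (φ θ)} : Set K),
      nrcVec (d := 3) (fun j => extVec F K n (w j)) ![η, 1] ∈ extSub K H)
    (hwH : ¬ Submodule.span F (Set.range w) ≤ H) : w 0 ∉ H := by
  intro h0
  refine hwH (Submodule.span_le.2 ?_)
  have n01 : φ θ - θ ≠ 0 := sub_ne_zero.2 hθ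
  have n02 : φ (φ θ) - θ ≠ 0 := sub_ne_zero.2 (frob_frob_ne hK hθ)
  have n12 : φ (φ θ) - φ θ ≠ 0 := sub_ne_zero.2 fun h => hθ (frob_injective h)
  have g0 := hw θ (by simp)
  have g1 := hw (φ θ) (by simp)
  have g2 := hw (φ (φ θ)) (by simp)
  generalize φ (φ θ) = θ₂ at *
  generalize φ θ = θ₁ at *
  have e0 : extVec F K n (w 0) ∈ extSub K H := extVec_mem_extSub h0
  simp only [nrcVec_three, Matrix.cons_val_zero, Matrix.cons_val_one, one_pow, mul_one,
    one_smul] at g0 g1 g2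
  -- divided differences of the vector polynomial `η² x₁ + η x₂ + x₃`
  have d01 : (θ₁ + θ) • extVec F K n (w 1) + extVec F K n (w 2) ∈ extSub K H := by
    rw [← Submodule.smul_mem_iff _ n01]
    convert sub_mem (sub_mem g1 (Submodule.smul_mem _ (θ₁ ^ 3) e0))
      (sub_mem g0 (Submodule.smul_mem _ (θ ^ 3) e0)) using 1
    module
  have d02 : (θ₂ + θ) • extVec F K n (w 1) + extVec F K n (w 2) ∈ extSub K H := by
    rw [← Submodule.smul_mem_iff _ n02]
    convert sub_mem (sub_mem g2 (Submodule.smul_mem _ (θ₂ ^ 3) e0))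
      (sub_mem g0 (Submodule.smul_mem _ (θ ^ 3) e0)) using 1
    module
  have e1 : extVec F K n (w 1) ∈ extSub K H := by
    rw [← Submodule.smul_mem_iff _ n12]
    convert sub_mem d02 d01 using 1
    module
  have e2 : extVec F K n (w 2) ∈ extSub K H := by
    convert sub_mem d01 (Submodule.smul_mem _ (θ₁ + θ) e1) using 1
    module
  have e3 : extVec F K n (w 3) ∈ extSub K H := by
    convert sub_mem (sub_mem (sub_mem g0 (Submodule.smul_mem _ (θ ^ 3) e0))
      (Submodule.smul_mem _ (θ ^ 2) e1)) (Submodule.smul_mem _ θ e2) using 1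
    module
  rintro _ ⟨i, rfl⟩
  rw [SetLike.mem_coe, ← extVec_mem_extSub_iff (K := K)]
  fin_cases i <;> assumption

/-- A non-rational point of an extended normal rational curve has a parameter `(θ : 1)` with
`θ ∉ F`. -/
theorem exists_param_not_rational (hK : Module.finrank F K = 3) {n d : ℕ}
    {w : Fin (d + 1) → Fin n → F} (hw : LinearIndependent F w) {X : ℙ K (Fin n → K)}
    (hX : X ∈ nrc K fun j => extVec F K n (w j))
    (hX' : ∀ Y : ℙ F (Fin n → F), (extPt F K n Y).submodule ≠ X.submodule) :
    ∃ θ : K, φ θ ≠ θ ∧ X.submodule = K ∙ nrcVec (fun j => extVec F K n (w j)) ![θ, 1] := by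
  obtain ⟨s, hs, hXs⟩ := hX
  have hrat : ∀ (t : Fin 2 → F) (c : K), t ≠ 0 → c ≠ 0 → s ≠ c • extVec F K 2 t := by
    rintro t c ht hc rfl
    rw [span_nrcVec_extVec w hc] at hXs
    exact hX' (Projectivization.mk F _ (nrcVec_ne_zero hw ht))
      ((extPt_mk_submodule _).trans hXs.symm)
  have hs1 : s 1 ≠ 0 := by
    intro h1
    refine hrat ![1, 0] (s 0) (fun h => one_ne_zero (congrFun h 0)) (fun h0 => hs ?_) ?_ <;>
    · ext i
      fin_cases i <;> simp [*, extVec]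
  have hsθ : s = s 1 • ![s 0 / s 1, 1] := by
    ext i
    fin_cases i <;> simp [hs1, mul_div_cancel₀]
  refine ⟨s 0 / s 1, fun h => ?_, ?_⟩
  · obtain ⟨a, ha⟩ := exists_algebraMap_eq_of_frob_eq hK h
    refine hrat ![a, 1] (s 1) (fun h => one_ne_zero (congrFun h 1)) hs1 (hsθ.trans ?_)
    rw [← ha]
    ext i
    fin_cases i <;> simp [extVec]
  · rw [hXs]
    conv_lhs => rw [hsθ]
    rw [nrcVec_smul]
    exact Submodule.span_singleton_smul_eq (IsUnit.mk0 _ (pow_ne_zero _ hs1)) _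

end CurveParameters

end BruckBose

open BruckBose

theorem theorem2 {F K : Type*} [Field F] [Fintype F] [Field K] [Algebra F K]
    (hK : Module.finrank F K = 3)
    -- the hyperplane at infinity and its regular 2-spread with transversal lines g, g^q, g^(q^2)
    (H : Submodule F (Fin 7 → F)) (hH : Module.finrank F H = 6)
    (S : Set (Submodule F (Fin 7 → F))) (g : Submodule K (Fin 7 → K))
    (hS : BruckBose.IsRegularSpread H S g)
    -- the spread element π with its transversal point P, and the conic f = 0 in π
    (π : Submodule F (Fin 7 → F)) (hπ : π ∈ S)
    (P : ℙ K (Fin 7 → K)) (hP : P.submodule = BruckBose.extSub K π ⊓ g)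
    (f : MvPolynomial (Fin 7) F) (hf : f.IsHomogeneous 2)
    (hf0 : ∃ v ∈ π, MvPolynomial.aeval v f ≠ 0)
    (hPC : ∀ i < 3, (BruckBose.frobPt F K 7)^[i] P ∈
      BruckBose.conic K (BruckBose.extSub K π) f)
    -- the spread element α with its transversal point Q, and the curve with basis w in T
    (α : Submodule F (Fin 7 → F)) (hα : α ∈ S) (hαπ : α ≠ π)
    (Q : ℙ K (Fin 7 → K)) (hQ : Q.submodule = BruckBose.extSub K α ⊓ g)
    (T : Submodule F (Fin 7 → F)) (hT : Module.finrank F T = 4) (hTH : ¬ T ≤ H) (hαT : α ≤ T)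
    (w : Fin 4 → Fin 7 → F) (hw : LinearIndependent F w)
    (hwT : Submodule.span F (Set.range w) = T)
    (hQN : ∀ i < 3, (BruckBose.frobPt F K 7)^[i] Q ∈
      BruckBose.nrc K (d := 3) (fun j => BruckBose.extVec F K 7 (w j))) :
    -- there is a unique projectivity of the extended curves that maps P^(q^i) to Q^(q^i)
    (∃! κ : BruckBose.conic K (BruckBose.extSub K π) f →
        BruckBose.nrc K (d := 3) (fun j => BruckBose.extVec F K 7 (w j)),
      BruckBose.IsProjectivity 2 3 κ ∧
      ∀ (i : ℕ) (hi : i < 3),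
        (κ ⟨_, hPC i hi⟩ : ℙ K (Fin 7 → K)) = (BruckBose.frobPt F K 7)^[i] Q) ∧
    -- the plane is PG(2, q^3)
    Nonempty (BruckBose.IncidenceIso (BruckBose.BBPoint H S) (BruckBose.BBLine H S)
      (ℙ K (Fin 3 → K)) (ℙ K (Fin 3 → K))) ∧
    ∀ κ : BruckBose.conic K (BruckBose.extSub K π) f →
        BruckBose.nrc K (d := 3) (fun j => BruckBose.extVec F K 7 (w j)),
      BruckBose.IsProjectivity 2 3 κ →
      (∀ (i : ℕ) (hi : i < 3),
        (κ ⟨_, hPC i hi⟩ : ℙ K (Fin 7 → K)) = (BruckBose.frobPt F K 7)^[i] Q) →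
      -- the ruled surface of κ meets PG(6, q) in a ruled surface with directrices C and N
      (∃ κ₀ : BruckBose.conic F π f → BruckBose.nrc F (d := 3) w,
        BruckBose.IsProjectivity 2 3 κ₀ ∧
        BruckBose.extPt F K 7 ⁻¹' BruckBose.ruledSurface κ = BruckBose.ruledSurface κ₀) ∧
      -- which corresponds to a subplane of order q tangent to the line at infinity
      ∀ Φ : BruckBose.IncidenceIso (BruckBose.BBPoint H S) (BruckBose.BBLine H S)
          (ℙ K (Fin 3 → K)) (ℙ K (Fin 3 → K)),
        BruckBose.IsSubplaneOfOrder (ℙ K (Fin 3 → K))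
          (Φ.onPoints '' BruckBose.bbSet H S
            (BruckBose.extPt F K 7 ⁻¹' BruckBose.ruledSurface κ)) (Fintype.card F) ∧
        BruckBose.IsTangent (Φ.onLines .infinity)
          (Φ.onPoints '' BruckBose.bbSet H S
            (BruckBose.extPt F K 7 ⁻¹' BruckBose.ruledSurface κ)) := by
  classical
  have hfinK := finite_of_finrank_eq_three hK
  have hcard : 8 ≤ Nat.card K := by
    have : FiniteDimensional F K := Module.finite_of_finrank_pos (by omega)
    rw [Module.natCard_eq_pow_finrank (K := F), hK, Nat.card_eq_fintype_card]
    exact Nat.pow_le_pow_left (Fintype.one_lt_card (α := F)) 3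
  have hwK := linearIndependent_extVec (K := K) hw
  -- `Q` has a parameter `(θ : 1)` on the cubic, with `θ` not in `F` since `g` has no rational point
  have hPrep := P.submodule_eq
  have hp₀ := P.rep_nonzero
  generalize P.rep = p₀ at hPrep hp₀
  obtain ⟨hp₀g, hπ₀, hπext⟩ := hS.eq_of_submodule_eq hK hπ hp₀ (hPrep.symm.trans hP)
  obtain ⟨θ, hθ, hQθ⟩ := exists_param_not_rational (d := 3) (w := w) (X := Q) hK hw
    (hQN 0 (by norm_num))
    (fun Y h => hS.disjoint Y (h.le.trans (hQ.le.trans inf_le_right)))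
  obtain ⟨r, hr⟩ : ∃ r, r =
    nrcVec (d := 3) (fun j => extVec F K 7 (w j)) ![θ, 1] := ⟨_, rfl⟩
  rw [← hr] at hQθ
  have hr0 : r ≠ 0 := hr ▸ nrcVec_ne_zero (d := 3) hwK
    fun h => one_ne_zero (congrFun h 1)
  obtain ⟨hrg, hα₀, hαext⟩ := hS.eq_of_submodule_eq hK hα hr0 (hQθ.symm.trans hQ)
  -- a multiple `p` of the vector of `P` brings the conic into its normal form for this same `θ`
  have hfp₀ : MvPolynomial.aeval p₀ f = 0 :=
    (hPC 0 (by norm_num)).2 p₀ (hPrep ▸ Submodule.mem_span_singleton_self p₀)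
  obtain ⟨b, c, hb, hc, hform⟩ := exists_conic_normal_form hK hθ hf hfp₀ (by
    obtain ⟨v, hv, hv0⟩ := hf0
    refine ⟨_, hπext ▸ extVec_mem_extSub hv, ?_⟩
    rwa [aeval_extVec, Ne, map_eq_zero_iff _ (algebraMap F K).injective])
  have hPb : P.submodule = K ∙ b • p₀ := by
    rw [hPrep, Submodule.span_singleton_smul_eq (IsUnit.mk0 _ hb)]
  have hp0 : b • p₀ ≠ 0 := smul_ne_zero hb hp₀
  generalize b • p₀ = p at hform hPb hp0
  obtain ⟨hpg, hπ₀, hπext⟩ := hS.eq_of_submodule_eq hK hπ hp0 (hPb.symm.trans hP)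
  have hC := conic_eq_nrc hK hθ hf hπext hc hform
  have hu := linearIndependent_conicFrame hK hθ (hS.traceMap_injective hK hpg hp0)
  set u := conicFrame F θ p with hudef
  have huK := linearIndependent_extVec (K := K) hu
  have n01 : FiniteField.frobeniusAlgHom F K θ - θ ≠ 0 := sub_ne_zero.2 hθ
  have n02 := sub_ne_zero.2 (frob_frob_ne hK hθ)
  have n12 : FiniteField.frobeniusAlgHom F K (FiniteField.frobeniusAlgHom F K θ) -
      FiniteField.frobeniusAlgHom F K θ ≠ 0 :=
    sub_ne_zero.2 fun h => hθ (frob_injective h)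
  have hk0 : (θ - FiniteField.frobeniusAlgHom F K θ) *
      (θ - FiniteField.frobeniusAlgHom F K (FiniteField.frobeniusAlgHom F K θ)) ≠ 0 :=
    mul_ne_zero (sub_ne_zero.2 (Ne.symm hθ)) (sub_ne_zero.2 (frob_frob_ne hK hθ).symm)
  -- both triples of transversal points have the parameters `(θ : 1)` and its conjugates
  have hPθ : P.submodule =
      K ∙ nrcVec (d := 2) (fun j => extVec F K 7 (u j)) ![θ, 1] := by
    have : conicVec F θ p ![θ, 1] = ((θ - FiniteField.frobeniusAlgHom F K θ) *
        (θ - FiniteField.frobeniusAlgHom F K (FiniteField.frobeniusAlgHom F K θ))) • p := by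
      simp [conicVec, linForm, -FiniteField.frobeniusAlgHom_apply]
    rw [hudef, nrcVec_conicFrame hK, this,
      Submodule.span_singleton_smul_eq (IsUnit.mk0 _ hk0), hPb]
  have hPi : ∀ i, ((frobPt F K 7)^[i] P).submodule =
      K ∙ nrcVec (d := 2) (fun j => extVec F K 7 (u j))
        ![(FiniteField.frobeniusAlgHom F K)^[i] θ, 1] := by
    intro i
    induction i with
    | zero => exact hPθ
    | succ i ih =>
      rw [Function.iterate_succ_apply', Function.iterate_succ_apply']
      exact frobPt_submodule_nrcVec u ih
  have hQi : ∀ i, ((frobPt F K 7)^[i] Q).submodule =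
      K ∙ nrcVec (d := 3) (fun j => extVec F K 7 (w j))
        ![(FiniteField.frobeniusAlgHom F K)^[i] θ, 1] := by
    intro i
    induction i with
    | zero => exact hr ▸ hQθ
    | succ i ih =>
      rw [Function.iterate_succ_apply', Function.iterate_succ_apply']
      exact frobPt_submodule_nrcVec w ih
  have hpt : ∀ η : K, (![η, 1] : Fin 2 → K) ≠ 0 := fun η h => one_ne_zero (congrFun h 1)
  have hbr : ∀ η ζ : K, ζ - η ≠ 0 → bracket ![η, 1] ![ζ, 1] ≠ 0 := by
    intro η ζ h h'
    simp only [bracket, Matrix.cons_val_zero, Matrix.cons_val_one] at h'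
    exact h (by linear_combination -h')
  -- every projectivity with the prescribed values preserves the parameters
  have hparam : ∀ κ : conic K (extSub K π) f →
      nrc K (d := 3) (fun j => extVec F K 7 (w j)),
      IsProjectivity 2 3 κ →
      (∀ (i : ℕ) (hi : i < 3),
        (κ ⟨_, hPC i hi⟩ : ℙ K (Fin 7 → K)) = (frobPt F K 7)^[i] Q) →
      ∀ (X : conic K (extSub K π) f) (s : Fin 2 → K), s ≠ 0 →
        X.1.submodule =
          K ∙ nrcVec (d := 2) (fun j => extVec F K 7 (u j)) s →
        (κ X).1.submodule =
          K ∙ nrcVec (d := 3) (fun j => extVec F K 7 (w j)) s := by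
    intro κ hκ hκi X s hs hX
    have hκi' : ∀ (i : ℕ) (hi : i < 3), (κ ⟨_, hPC i hi⟩).1.submodule =
        K ∙ nrcVec (d := 3) (fun j => extVec F K 7 (w j))
          ![(FiniteField.frobeniusAlgHom F K)^[i] θ, 1] := by
      intro i hi
      rw [hκi i hi]
      exact hQi i
    exact hκ.preserves_parameter (u := fun j => extVec F K 7 (u j))
      (w := fun j => extVec F K 7 (w j)) (by norm_num) (by norm_num) (by omega) (by omega)
      huK hwK hC rfl
      (hpt _) (hpt _) (hpt _) (hbr _ _ n01) (hbr _ _ n02) (hbr _ _ n12)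
      (hPi 0) (hPi 1) (hPi 2) (hκi' 0 (by norm_num)) (hκi' 1 (by norm_num))
      (hκi' 2 (by norm_num)) X hs hX
  -- the directrices lie in skew subspaces, as `T` meets `H` in `α`, which is skew to `π`
  have hTα : T ⊓ H = α := by
    refine (Submodule.eq_of_le_of_finrank_le (le_inf hαT (hS.isTwoSpread.le α hα)) ?_).symm
    have hlt : T ⊓ H < T := lt_of_le_of_ne inf_le_left fun h => hTH (inf_eq_left.1 h)
    have := Submodule.finrank_lt_finrank_of_lt hlt
    rw [hS.isTwoSpread.finrank_eq α hα]
    omega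
  have huπ : Submodule.span F (Set.range u) ≤ π := by
    rw [hπ₀, Submodule.span_le]
    rintro _ ⟨i, rfl⟩
    fin_cases i
    · exact ⟨_, rfl⟩
    · exact neg_mem ⟨_, rfl⟩
    · exact ⟨_, rfl⟩
  have hdisj : Disjoint (Submodule.span F (Set.range u)) (Submodule.span F (Set.range w)) := by
    rw [hwT]
    refine Disjoint.mono_left huπ (disjoint_iff_inf_le.2 ?_)
    rw [← hS.inf_eq_bot hπ hα hαπ.symm]
    exact le_inf inf_le_left
      (hTα ▸ le_inf inf_le_right (inf_le_left.trans (hS.isTwoSpread.le π hπ)))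
  -- with the multiple `ρ` of `r`, the cubic is `L₀ L₁ L₂ w₀` plus `s₁` times a conic of the same
  -- form as the given one
  have hcubic := nrcVec_cubic hK hθ w
  simp only [← hr] at hcubic
  have hρ0 : ((θ - FiniteField.frobeniusAlgHom F K θ) *
      (θ - FiniteField.frobeniusAlgHom F K (FiniteField.frobeniusAlgHom F K θ)))⁻¹ • r ≠ 0 :=
    smul_ne_zero (inv_ne_zero hk0) hr0
  have hρg := g.smul_mem ((θ - FiniteField.frobeniusAlgHom F K θ) *
      (θ - FiniteField.frobeniusAlgHom F K (FiniteField.frobeniusAlgHom F K θ)))⁻¹ hrg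
  have hρQ : Q.submodule = K ∙ (((θ - FiniteField.frobeniusAlgHom F K θ) *
      (θ - FiniteField.frobeniusAlgHom F K (FiniteField.frobeniusAlgHom F K θ)))⁻¹ • r) := by
    rw [Submodule.span_singleton_smul_eq (IsUnit.mk0 _ (inv_ne_zero hk0)), hQθ]
  generalize ((θ - FiniteField.frobeniusAlgHom F K θ) *
      (θ - FiniteField.frobeniusAlgHom F K (FiniteField.frobeniusAlgHom F K θ)))⁻¹ • r = ρ
    at hcubic hρ0 hρg hρQ
  have hpρ : LinearIndependent K ![p, ρ] := by
    rw [LinearIndependent.pair_iff' hp0]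
    rintro a rfl
    have ha : a ≠ 0 := fun ha => hρ0 (by rw [ha, zero_smul])
    have hPQ : P.submodule = Q.submodule := by
      rw [hρQ, hPb, Submodule.span_singleton_smul_eq (IsUnit.mk0 _ ha)]
    have hα₁ := (hS.eq_of_submodule_eq hK hα hp0
      (hPb.symm.trans (hPQ.trans hQ))).2.1
    exact hαπ (hα₁.trans hπ₀.symm)
  have hw0 : w 0 ∉ H := by
    refine frame_zero_notMem hK hθ ?_ (hwT ▸ hTH)
    have hαH : conjSpan F r ≤ extSub K H :=
      hαext ▸ extSub_mono (hS.isTwoSpread.le α hα)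
    rintro η (rfl | rfl | rfl)
    · exact hαH (mem_conjSpan.2 ⟨1, 0, 0, by simp [hr]⟩)
    · rw [← frobVec_nrcVec]
      exact hαH (mem_conjSpan.2 ⟨0, 1, 0, by simp [hr]⟩)
    · rw [← frobVec_nrcVec, ← frobVec_nrcVec]
      exact hαH (mem_conjSpan.2 ⟨0, 0, 1, by simp [hr]⟩)
  -- equality of parameters defines the projectivity over `K` and its restriction over `F`
  have hC₀ : conic F π f = nrc F (d := 2) u := by
    ext X
    rw [← extPt_mem_conic_iff (K := K) hf, hC,
      extPt_mem_nrc_iff (by norm_num) hu]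
  obtain ⟨κ₁, hκ₁⟩ := exists_parameter_map (d := 2) (e := 3)
    (u := fun j => extVec F K 7 (u j)) (w := fun j => extVec F K 7 (w j))
    (by norm_num) huK hwK hC
  obtain ⟨κ₀, hκ₀⟩ := exists_parameter_map (d := 2) (e := 3) (u := u) (w := w)
    (by norm_num) hu hw hC₀
  have hκ₁p : IsProjectivity 2 3 κ₁ := ⟨fun j => extVec F K 7 (u j),
    fun j => extVec F K 7 (w j), huK, hwK, hC, rfl, hκ₁⟩
  have hκ₁i : ∀ (i : ℕ) (hi : i < 3),
      (κ₁ ⟨_, hPC i hi⟩ : ℙ K (Fin 7 → K)) = (frobPt F K 7)^[i] Q := by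
    intro i hi
    refine Projectivization.submodule_injective ?_
    rw [hκ₁ ⟨_, hPC i hi⟩ _ (hpt _) (hPi i)]
    exact (hQi i).symm
  have hpre : ∀ κ : conic K (extSub K π) f →
      nrc K (d := 3) (fun j => extVec F K 7 (w j)),
      IsProjectivity 2 3 κ →
      (∀ (i : ℕ) (hi : i < 3),
        (κ ⟨_, hPC i hi⟩ : ℙ K (Fin 7 → K)) = (frobPt F K 7)^[i] Q) →
      extPt F K 7 ⁻¹' ruledSurface κ = ruledSurface κ₀ :=
    fun κ hκ hκi => preimage_ruledSurface (u := u) (w := w) (by norm_num) (by norm_num)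
      hu hw hdisj hC hC₀ (hparam κ hκ hκi) hκ₀
  have hplane := isSubplane_and_isTangent hK hS hθ hpg hρg hpρ hw0 hcubic
    (mem_ruledSurface_iff hu hC₀ hκ₀)
  refine ⟨⟨κ₁, ⟨hκ₁p, hκ₁i⟩, ?_⟩, hplane.1, fun κ hκ hκi => ?_⟩
  · rintro κ ⟨hκ, hκi⟩
    ext1 X
    obtain ⟨s, hs, hX⟩ : X.1 ∈ nrc K (d := 2) fun j => extVec F K 7 (u j) :=
      hC ▸ X.2
    refine Subtype.ext (Projectivization.submodule_injective ?_)
    rw [hparam κ hκ hκi X s hs hX, hκ₁ X s hs hX]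
  · rw [hpre κ hκ hκi]
    exact ⟨⟨κ₀, ⟨u, w, hu, hw, hC₀, rfl, hκ₀⟩, rfl⟩, hplane.2⟩
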